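/- **Setting.** Let $d\ge 1$, let $\Omega\subset[0,1]^d$ be a nonempty open set whose boundary has finite $(d-1)$-dimensional surface measure $|\partial\Omega|$, and let $\alpha\in\mathbb R$, $\beta\in\mathbb R\setminus\{0\}$. Let $a_{ij}\in C(\bar\Omega)$, $b_i,c\in L^\infty(\Omega)$ $(1\le i,j\le d)$, $f\in L^2(\Omega)$, $g\in L^2(\partial\Omega)$. For $u,v\in C^1(\mathbb R^d)$ put $$\mathcal L(u,v)=\sum_{i,j=1}^d(a_{ij}\partial_iu,\partial_jv)_{\Omega}+\sum_{i=1}^d(b_i\partial_iu,v)_{\Omega}+(cu,v)_{\Omega}+\frac{\alpha}{\beta}(u,v)_{\partial\Omega}-(f,v)_{\Omega}-\frac1\beta(g,v)_{\partial\Omega},$$ where $(\cdot,\cdot)_\Omega$ and $(\cdot,\cdot)_{\partial\Omega}$ are the $L^2$ pairings, and, for sample points $X_1,\dots,X_N\in\Omega$ and $Y_1,\dots,Y_M\in\partial\Omega$, $$\widehat{\mathcal L}(u,v)=\frac{|\Omega|}{N}\sum_{k=1}^N\Big(\sum_{i,j=1}^da_{ij}\partial_iu\,\partial_jv+\sum_{i=1}^db_i\,\partial_iu\,v+cuv-fv\Big)(X_k)+\frac{|\partial\Omega|}{\beta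 M}\sum_{k=1}^M\big(\alpha uv-gv\big)(Y_k).$$ For a set $\mathcal P$ of $C^1$ functions let $$\mathcal L_1(u)=\sup_{v\in\mathcal P}\mathcal L(u,v),\qquad \mathcal L_2(u)=\sup_{v\in\mathcal P}\widehat{\mathcal L}(u,v),\qquad \mathcal E_{sta}=2\sup_{u\in\mathcal P}|\mathcal L_1(u)-\mathcal L_2(u)|.$$ For $\rho:\mathbb R\to\mathbb R$, let $\mathcal N_\rho(\mathcal D,\mathfrak n_{\mathcal D},B_\theta)$ be the set of functions $\mathbf f:\mathbb R^d\to\mathbb R$ of the form $\mathbf f_0(x)=x$, $\mathbf f_\ell=\rho(A_\ell\mathbf f_{\ell-1}+\mathbf b_\ell)$ $(1\le\ell\le\mathcal D-1$, $\rho$ acting componentwise$)$, $\mathbf f=A_{\mathcal D}\mathbf f_{\mathcal D-1}+\mathbf b_{\mathcal D}$, with $A_\ell\in\mathbb R^{n_\ell\times n_{\ell-1}}$, $\mathbf b_\ell\in\mathbb R^{n_\ell}$, $n_0=d$, $n_{\mathcal D}=1$, arbitrary hidden widths $n_\ell\ge1$, at most $\mathfrak n_{\mathcal D}$ nonzero weights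 (entries of all the $A_\ell$ and $\mathbf b_\ell$) in total, and all weights bounded by $B_\theta$ in absolute value. **Theorem.** For all $\alpha,K,S\in\mathbb R$ there is a constant $C=C(\alpha,K,S)$ such that the following holds for all $d$, $\Omega$, $\beta$, $a_{ij},b_i,c,f,g$ as above with $|\partial\Omega|\le S$ and with the norms $\|a_{ij}\|_{C(\bar\Omega)}$, $\|b_i\|_{L^\infty(\Omega)}$, $\|c\|_{L^\infty(\Omega)}$, $\|f\|_{L^2(\Omega)}$, $\|g\|_{L^2(\partial\Omega)}$ all at most $K$. Let $\mathcal D,\mathfrak n_{\mathcal D}\ge1$ be integers, let $B_\theta\ge1$, let $\rho$ be differentiable with $\rho$ and $\rho'$ both bounded by $1$ and both $1$-Lipschitz, and let $\mathcal P\subset\mathcal N_\rho(\mathcal D,\mathfrak n_{\mathcal D},B_\theta)$ be nonempty. Let $N=M\ge1$, let $X_1,\dots,X_N$ be i.i.d. uniform on $\Omega$ and, independently, $Y_1,\dots,Y_N$ i.i.d. uniform on $\partial\Omega$. Then the suprema that define $\mathcal L_1,\mathcal L_2$ on $\mathcal P$ and $\mathcal E_{sta}$ are finite, $\mathcal E_{sta}$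 is integrable, and $$\mathbb E\,\mathcal E_{sta}\le C\,\max\Big\{1,\frac1{|\beta|}\Big\}\,\frac{d^3\,\mathcal D^{\frac12}\,\mathfrak n_{\mathcal D}^{\frac72\mathcal D-\frac32}\,B_\theta^{\frac72\mathcal D+\frac12}}{N^{\frac14}}.$$ In particular, for $0<\beta\le1$ the prefactor is $C/\beta$. -/

import Mathlib

open MeasureTheory ProbabilityTheory

noncomputable section

namespace DGMW

/-- Euclidean space `ℝ^d`. -/
abbrev Sp (d : ℕ) : Type := EuclideanSpace ℝ (Fin d)

/-! ### Fully connected networks with scalar output -/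

/-- The affine map `z ↦ A z + b`. -/
def affineMap {n k : ℕ} (A : Matrix (Fin k) (Fin n) ℝ) (b : Fin k → ℝ) (z : Fin n → ℝ) :
    Fin k → ℝ :=
  fun q => (∑ j, A q j * z j) + b q

/-- The number of nonzero weights of one layer (matrix entries and biases). -/
def layerNonzero {n k : ℕ} (A : Matrix (Fin k) (Fin n) ℝ) (b : Fin k → ℝ) : ℕ :=
  Set.ncard {p : Fin k × Fin n | A p.1 p.2 ≠ 0} + Set.ncard {q : Fin k | b q ≠ 0}

/-- All weights of one layer are bounded in absolute value by `B`. -/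
def layerBounded {n k : ℕ} (A : Matrix (Fin k) (Fin n) ℝ) (b : Fin k → ℝ) (B : ℝ) : Prop :=
  (∀ q j, |A q j| ≤ B) ∧ ∀ q, |b q| ≤ B

/-- The weight parameters of a network with `n` inputs and one output: either a single (output)
layer, or a first hidden layer of positive width `k`, followed by a network with `k` inputs. -/
inductive Net : ℕ → Type
  | output {n : ℕ} (A : Matrix (Fin 1) (Fin n) ℝ) (b : Fin 1 → ℝ) : Net n
  | hidden {n k : ℕ} (hk : 0 < k) (A : Matrix (Fin k) (Fin n) ℝ) (b : Fin k → ℝ)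
      (rest : Net k) : Net n

namespace Net

/-- The number of layers, the output layer included. -/
def depth : {n : ℕ} → Net n → ℕ
  | _, output _ _ => 1
  | _, hidden _ _ _ rest => rest.depth + 1

/-- The total number of nonzero weights. -/
def numNonzero : {n : ℕ} → Net n → ℕ
  | _, output A b => layerNonzero A b
  | _, hidden _ A b rest => layerNonzero A b + rest.numNonzero

/-- All weights are bounded in absolute value by `B`. -/
def WeightsBounded (B : ℝ) : {n : ℕ} → Net n → Prop
  | _, output A b => layerBounded A b B
  | _, hidden _ A b rest => layerBounded A b B ∧ rest.WeightsBounded B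

/-- The function implemented by the network; the activation `ρ` acts componentwise after every
layer except the output layer. -/
def eval (ρ : ℝ → ℝ) : {n : ℕ} → Net n → (Fin n → ℝ) → ℝ
  | _, output A b, z => affineMap A b z 0
  | _, hidden _ A b rest, z => rest.eval ρ (fun q => ρ (affineMap A b z q))

end Net

/-- The functions on `ℝ^d` implemented by `ρ`-networks of depth `D`, with at most `𝔫` nonzero
weights, all of them bounded by `B`. The widths of the hidden layers are arbitrary. -/
def networkClass (d : ℕ) (ρ : ℝ → ℝ) (D 𝔫 : ℕ) (B : ℝ) : Set (Sp d → ℝ) :=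
  {u | ∃ Φ : Net d, Φ.depth = D ∧ Φ.numNonzero ≤ 𝔫 ∧ Φ.WeightsBounded B ∧
    ∀ x : Sp d, u x = Φ.eval ρ (fun i => x i)}

/-! ### The Galerkin functional, its empirical version, the statistical error -/

/-- The partial derivative `∂_i u (x)`. -/
def pd {d : ℕ} (i : Fin d) (u : Sp d → ℝ) (x : Sp d) : ℝ :=
  fderiv ℝ u x (EuclideanSpace.single i 1)

/-- The `(d-1)`-dimensional surface measure (normalized Hausdorff measure) on `ℝ^d`. -/
def surf (d : ℕ) : Measure (Sp d) := Measure.euclideanHausdorffMeasure (d - 1)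

/-- The data of the Robin problem: the coefficients `a_ij`, `b_i`, `c`, the source `f` and the
boundary datum `g`. -/
structure Coeffs (d : ℕ) where
  a : Fin d → Fin d → Sp d → ℝ
  b : Fin d → Sp d → ℝ
  c : Sp d → ℝ
  f : Sp d → ℝ
  g : Sp d → ℝ

/-- `a_ij ∈ C(closure Ω)`, `b_i, c ∈ L^∞(Ω)`, `f ∈ L²(Ω)`, `g ∈ L²(∂Ω)`, and the corresponding
norms of all these functions are at most `K`. -/
structure Coeffs.Admissible {d : ℕ} (p : Coeffs d) (Ω : Set (Sp d)) (K : ℝ) : Prop where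
  a_cont : ∀ i j, ContinuousOn (p.a i j) (closure Ω)
  a_le : ∀ i j, ∀ x ∈ closure Ω, |p.a i j x| ≤ K
  b_mem : ∀ i, MemLp (p.b i) ⊤ (volume.restrict Ω)
  b_le : ∀ i, eLpNorm (p.b i) ⊤ (volume.restrict Ω) ≤ ENNReal.ofReal K
  c_mem : MemLp p.c ⊤ (volume.restrict Ω)
  c_le : eLpNorm p.c ⊤ (volume.restrict Ω) ≤ ENNReal.ofReal K
  f_mem : MemLp p.f 2 (volume.restrict Ω)
  f_le : eLpNorm p.f 2 (volume.restrict Ω) ≤ ENNReal.ofReal K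
  g_mem : MemLp p.g 2 ((surf d).restrict (frontier Ω))
  g_le : eLpNorm p.g 2 ((surf d).restrict (frontier Ω)) ≤ ENNReal.ofReal K

/-- The functional `𝓛(u, v)` of the weak formulation, for `u`, `v` that are `C¹` on `ℝ^d`
(so that their traces are their restrictions to `∂Ω`). -/
def galerkin {d : ℕ} (p : Coeffs d) (Ω : Set (Sp d)) (α β : ℝ) (u v : Sp d → ℝ) : ℝ :=
  (∑ i, ∑ j, ∫ x in Ω, p.a i j x * pd i u x * pd j v x)
    + (∑ i, ∫ x in Ω, p.b i x * pd i u x * v x)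
    + (∫ x in Ω, p.c x * u x * v x)
    + α / β * (∫ y in frontier Ω, u y * v y ∂(surf d))
    - (∫ x in Ω, p.f x * v x)
    - 1 / β * (∫ y in frontier Ω, p.g y * v y ∂(surf d))

/-- The empirical functional, built from the interior samples `X` and the boundary
samples `Y`. -/
def galerkinEmp {d : ℕ} (p : Coeffs d) (Ω : Set (Sp d)) (α β : ℝ) {N M : ℕ}
    (X : Fin N → Sp d) (Y : Fin M → Sp d) (u v : Sp d → ℝ) : ℝ :=
  volume.real Ω / N * (∑ k, ((∑ i, ∑ j, p.a i j (X k) * pd i u (X k) * pd j v (X k))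
      + (∑ i, p.b i (X k) * pd i u (X k) * v (X k))
      + p.c (X k) * u (X k) * v (X k) - p.f (X k) * v (X k)))
    + (surf d).real (frontier Ω) / (β * M) *
      (∑ k, (α * u (Y k) * v (Y k) - p.g (Y k) * v (Y k)))

/-- `𝓛₁(u) = sup_{v ∈ P} 𝓛(u, v)`. -/
def loss {d : ℕ} (p : Coeffs d) (Ω : Set (Sp d)) (α β : ℝ) (P : Set (Sp d → ℝ))
    (u : Sp d → ℝ) : ℝ :=
  ⨆ v : P, galerkin p Ω α β u v

/-- `𝓛₂(u)`, the supremum over `v ∈ P` of the empirical functional. -/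
def lossEmp {d : ℕ} (p : Coeffs d) (Ω : Set (Sp d)) (α β : ℝ) (P : Set (Sp d → ℝ)) {N M : ℕ}
    (X : Fin N → Sp d) (Y : Fin M → Sp d) (u : Sp d → ℝ) : ℝ :=
  ⨆ v : P, galerkinEmp p Ω α β X Y u v

/-- The statistical error `2 sup_{u ∈ P} |𝓛₁(u) - 𝓛₂(u)|`. -/
def statError {d : ℕ} (p : Coeffs d) (Ω : Set (Sp d)) (α β : ℝ) (P : Set (Sp d → ℝ)) {N M : ℕ}
    (X : Fin N → Sp d) (Y : Fin M → Sp d) : ℝ :=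
  2 * ⨆ u : P, |loss p Ω α β P u - lossEmp p Ω α β P X Y u|

/-- The joint law of `N` i.i.d. samples from the uniform distribution `U(Ω)` and `M` i.i.d.
samples from the uniform distribution `U(∂Ω)`. -/
def sampleLaw {d : ℕ} (Ω : Set (Sp d)) (N M : ℕ) :
    Measure ((Fin N → Sp d) × (Fin M → Sp d)) :=
  (Measure.pi fun _ : Fin N => cond (volume : Measure (Sp d)) Ω).prod
    (Measure.pi fun _ : Fin M => cond (surf d) (frontier Ω))

end DGMW

end

/-!
As `|𝓛₁(u) - 𝓛₂(u)| ≤ sup_v |𝓛(u, v) - 𝓛̂(u, v)|`, the statistical error is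
controlled by the uniform deviation, over pairs of networks, of the empirical means of the single
terms `a_ij ∂_i u ∂_j v`, `b_i ∂_i u v`, `c u v`, `f v`, `u v`, `g v`.  Each of them is a fixed
square integrable weight `w` times a member of a bounded class of functions.

*Deviation of a class* (`exists_deviation_bound`).  If a class is bounded by `M` and is divided into
`m` cells of diameter `ε`, then the expected uniform deviation is at most
`‖w‖ (2 ε + 6 M √(log (2m) / N))`.  Passing to one representative of each cell costs `ε ‖w‖` twice.
The weight is clipped at a level `T`, which costs `M ‖w‖² / T` twice; for the clipped
representatives, Bernstein's bound for the moment generating function and a union bound apply.  As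
the variance is governed by `‖w‖` rather than by `T`, the level may be chosen so that all error
terms have the same order, and the mere square integrability of `f` and `g` does no harm.  The
deviation is bounded pointwise by an explicit integrable function, so no supremum has to be
integrated here.

*Cells of network classes* (`hasCells_neuronClass_outClass`).  The widths of the hidden layers are
arbitrary, but every neuron has at most `𝔫` nonzero incoming weights.  Unfolding a network into a
tree therefore leaves at most a multiple of `d 𝔫^(D-1)` weights, which are put on a grid, and cells
with respect to the values and the gradients on the unit cube are obtained by recursion over the
layers.  The logarithm of the number of cells is, up to logarithms, of the order `d 𝔫^(D-1)`, and its
square root fits into the powers of `𝔫` and `B` that the gradient bound `𝔫^(D-1) B^D` leaves over,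
if `𝔫 ≥ 2` or `D = 1`.  A network with `D ≥ 2` and a single nonzero weight has a vanishing layer and
is constant, so this remaining case reduces to that of affine functions (`exists_netLike`).

*Measurability* (`aemeasurable_statError`).  The cells of diameter `1 / (j + 1)` provide a countable
`C¹`-dense family, and all functionals are Lipschitz with respect to the `C¹` distance on the cube,
so the suprema may be taken over this family.
-/

namespace DGMW

/-! ### Uniform deviation of weighted empirical means -/

section Concentration

variable {E : Type*} [MeasurableSpace E]

theorem integral_exp_le_of_centered {μ : Measure E} [IsProbabilityMeasure μ] {Z : E → ℝ}
    {v : ℝ} (hZ : AEStronglyMeasurable Z μ) (hb : ∀ᵐ x ∂μ, |Z x| ≤ 1) (h0 : ∫ x, Z x ∂μ = 0)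
    (hv : ∫ x, Z x ^ 2 ∂μ ≤ v) : ∫ x, Real.exp (Z x) ∂μ ≤ Real.exp v := by
  have hZi : Integrable Z μ := Integrable.of_bound hZ 1 (by simpa using hb)
  have hZ2 : Integrable (fun x => Z x ^ 2) μ := by
    refine Integrable.of_bound (hZ.pow 2) 1 ?_
    filter_upwards [hb] with x hx
    rw [Real.norm_eq_abs, abs_pow]
    exact pow_le_one₀ (abs_nonneg _) hx
  have h1Z : Integrable (fun x => 1 + Z x) μ := (integrable_const _).add hZi
  have hexp : Integrable (fun x => Real.exp (Z x)) μ := by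
    refine Integrable.of_bound (Real.continuous_exp.comp_aestronglyMeasurable hZ) (Real.exp 1) ?_
    filter_upwards [hb] with x hx
    rw [Real.norm_eq_abs, Real.abs_exp]
    exact Real.exp_le_exp.2 (le_of_abs_le hx)
  calc ∫ x, Real.exp (Z x) ∂μ ≤ ∫ x, (1 + Z x + Z x ^ 2) ∂μ := by
        refine integral_mono_ae hexp (h1Z.add hZ2) ?_
        filter_upwards [hb] with x hx
        have := le_of_abs_le (Real.abs_exp_sub_one_sub_id_le hx)
        linarith
    _ = 1 + ∫ x, Z x ^ 2 ∂μ := by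
        rw [integral_add h1Z hZ2, integral_add (integrable_const _) hZi, h0]
        simp
    _ ≤ Real.exp v := by linarith [Real.add_one_le_exp v]

/-- Bernstein's bound for the moment generating function of a centred sum of i.i.d. variables. -/
theorem integral_exp_sum_le {μ : Measure E} [IsProbabilityMeasure μ] {F : E → ℝ} {b v r : ℝ}
    (N : ℕ) (hF : AEStronglyMeasurable F μ) (hb : ∀ᵐ x ∂μ, |F x| ≤ b)
    (hv : ∫ x, F x ^ 2 ∂μ ≤ v) (hr : 2 * |r| * b ≤ 1) :
    Integrable (fun X : Fin N → E => Real.exp (r * ∑ k, (F (X k) - ∫ x, F x ∂μ)))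
        (Measure.pi fun _ => μ) ∧
      ∫ X : Fin N → E, Real.exp (r * ∑ k, (F (X k) - ∫ x, F x ∂μ)) ∂(Measure.pi fun _ => μ) ≤
        Real.exp (N * (r ^ 2 * v)) := by
  set e := ∫ x, F x ∂μ with he
  have hFi : Integrable F μ := Integrable.of_bound hF b (by simpa using hb)
  have hF2 : Integrable (fun x => F x ^ 2) μ := by
    refine Integrable.of_bound (hF.pow 2) (b ^ 2) ?_
    filter_upwards [hb] with x hx
    rw [Real.norm_eq_abs, abs_pow]
    exact pow_le_pow_left₀ (abs_nonneg _) hx 2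
  have hmean : |e| ≤ b := by
    have := norm_integral_le_of_norm_le_const (μ := μ) (f := F) (C := b) (by simpa using hb)
    simpa using this
  have hZm : AEStronglyMeasurable (fun x => r * (F x - e)) μ :=
    (hF.sub aestronglyMeasurable_const).const_mul r
  have hZb : ∀ᵐ x ∂μ, |r * (F x - e)| ≤ 1 := by
    filter_upwards [hb] with x hx
    rw [abs_mul]
    have h1 : |F x - e| ≤ 2 * b := (abs_sub _ _).trans (by linarith)
    calc |r| * |F x - e| ≤ |r| * (2 * b) := by gcongr
      _ ≤ 1 := by linarith
  have hZ0 : ∫ x, r * (F x - e) ∂μ = 0 := by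
    rw [integral_const_mul, integral_sub hFi (integrable_const _)]
    simp [he]
  have hZv : ∫ x, (r * (F x - e)) ^ 2 ∂μ ≤ r ^ 2 * v := by
    have h1 : ∀ x, (r * (F x - e)) ^ 2 = r ^ 2 * (F x ^ 2 - 2 * e * F x + e ^ 2) := by
      intro x; ring
    have h2 : Integrable (fun x => F x ^ 2 - 2 * e * F x) μ := hF2.sub (hFi.const_mul _)
    simp_rw [h1]
    rw [integral_const_mul, integral_add h2 (integrable_const _),
      integral_sub hF2 (hFi.const_mul _), integral_const_mul, ← he]
    refine mul_le_mul_of_nonneg_left ?_ (sq_nonneg r)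
    simp only [integral_const, probReal_univ, one_smul]
    nlinarith [sq_nonneg e]
  have hprod : ∀ X : Fin N → E, Real.exp (r * ∑ k, (F (X k) - e)) =
      ∏ k, Real.exp (r * (F (X k) - e)) := by
    intro X
    rw [Finset.mul_sum, Real.exp_sum]
  have hexp : Integrable (fun x => Real.exp (r * (F x - e))) μ := by
    refine Integrable.of_bound (Real.continuous_exp.comp_aestronglyMeasurable hZm) (Real.exp 1) ?_
    filter_upwards [hZb] with x hx
    rw [Real.norm_eq_abs, Real.abs_exp]
    exact Real.exp_le_exp.2 (le_of_abs_le hx)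
  simp_rw [hprod]
  refine ⟨Integrable.fintype_prod (f := fun _ x => Real.exp (r * (F x - e))) fun _ => hexp, ?_⟩
  rw [integral_fintype_prod_eq_prod (fun _ x => Real.exp (r * (F x - e)))]
  rw [Finset.prod_const, Finset.card_univ, Fintype.card_fin, Real.exp_nat_mul]
  exact pow_le_pow_left₀ (integral_nonneg fun _ => (Real.exp_pos _).le)
    (integral_exp_le_of_centered hZm hZb hZ0 hZv) N

/-- Clipping `y` to `[-T, T]`. -/
def clip (T y : ℝ) : ℝ := max (-T) (min T y)

theorem continuous_clip (T : ℝ) : Continuous (clip T) := by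
  unfold clip; fun_prop

theorem abs_clip_le {T : ℝ} (hT : 0 ≤ T) (y : ℝ) : |clip T y| ≤ T := by
  unfold clip; grind

theorem abs_clip_le_abs {T : ℝ} (hT : 0 ≤ T) (y : ℝ) : |clip T y| ≤ |y| := by
  unfold clip; grind

theorem abs_sub_clip_le {T : ℝ} (hT : 0 < T) (y : ℝ) : |y - clip T y| ≤ y ^ 2 / T := by
  rcases le_total |y| T with h | h
  · have : clip T y = y := by unfold clip; grind
    rw [this, sub_self, abs_zero]; positivity
  · have h1 : |y - clip T y| ≤ |y| := by unfold clip; grind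
    refine h1.trans ?_
    rw [le_div_iff₀ hT, ← sq_abs, sq]
    exact mul_le_mul_of_nonneg_left h (abs_nonneg y)

/-- The uniform deviation of the empirical means of a weighted class of bounded functions.  If the
functions `h t` are bounded by `M` and fall into `m` cells of diameter `ε`, then their weighted
empirical means deviate from the means by at most `Ψ`, and the expectation of `Ψ` has the order
`ε + M √(log (2m) / N)`.  The weight `w` need only be square integrable. -/
theorem exists_deviation_bound {μ : Measure E} [IsProbabilityMeasure μ] {A : Set E}
    (hA : ∀ᵐ x ∂μ, x ∈ A) {w : E → ℝ} {W : ℝ} (hW : 0 < W) (hw : MemLp w 2 μ)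
    (hwW : ∫ x, w x ^ 2 ∂μ ≤ W ^ 2) {T : Type*} [Nonempty T] {h : T → E → ℝ} {M ε : ℝ}
    (hM : 0 < M) (hε : 0 ≤ ε) (hmeas : ∀ t, AEStronglyMeasurable (h t) μ)
    (hhM : ∀ t, ∀ x ∈ A, |h t x| ≤ M) {m : ℕ} (κ : T → Fin m)
    (hκ : ∀ s t, κ s = κ t → ∀ x ∈ A, |h s x - h t x| ≤ ε) {N : ℕ} (hN : 1 ≤ N) :
    ∃ Ψ : (Fin N → E) → ℝ, Integrable Ψ (Measure.pi fun _ => μ) ∧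
      (∀ᵐ X ∂(Measure.pi fun _ : Fin N => μ), ∀ t,
        |1 / (N : ℝ) * ∑ k, w (X k) * h t (X k) - ∫ x, w x * h t x ∂μ| ≤ Ψ X) ∧
      ∫ X, Ψ X ∂(Measure.pi fun _ => μ) ≤
        W * (2 * ε + 6 * M * √(Real.log (2 * m) / N)) := by
  have hm : 1 ≤ m := by
    rcases m with _ | m
    · exact (κ (Classical.arbitrary T)).elim0
    · omega
  have hm' : (1 : ℝ) ≤ m := by exact_mod_cast hm
  have hN0 : (0 : ℝ) < N := by exact_mod_cast hN
  set lg := Real.log (2 * m) with hlg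
  have hlg0 : 0 < lg := Real.log_pos (by linarith)
  set σ := √(lg / N) with hσ
  have hσ0 : 0 < σ := Real.sqrt_pos.2 (by positivity)
  have hσ2 : σ ^ 2 = lg / N := Real.sq_sqrt (by positivity)
  -- The truncation level and the exponent are balanced so that `2 r M T = 1`.
  set T₀ := W / (2 * σ) with hT₀
  have hT0 : 0 < T₀ := by positivity
  set r := σ / (M * W) with hr
  have hr0 : 0 < r := by positivity
  set w₁ : E → ℝ := fun x => clip T₀ (w x) with hw₁
  have hw₁m : AEStronglyMeasurable w₁ μ :=
    (continuous_clip T₀).comp_aestronglyMeasurable hw.aestronglyMeasurable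
  have hw2 : Integrable (fun x => w x ^ 2) μ := hw.integrable_sq
  have hwi : Integrable w μ := hw.integrable (by norm_num)
  have hwabs : ∫ x, |w x| ∂μ ≤ W := by
    have h1 : ∀ x, |w x| ≤ (1 / (2 * W)) * w x ^ 2 + W / 2 := by
      intro x
      have := sq_nonneg (|w x| - W)
      rw [← sq_abs (w x)]
      have h2 : (1 / (2 * W)) * |w x| ^ 2 + W / 2 - |w x| = (1 / (2 * W)) * (|w x| - W) ^ 2 := by
        field_simp; ring
      have h3 : 0 ≤ (1 / (2 * W)) * (|w x| - W) ^ 2 := by positivity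
      linarith
    calc ∫ x, |w x| ∂μ ≤ ∫ x, ((1 / (2 * W)) * w x ^ 2 + W / 2) ∂μ :=
          integral_mono hwi.abs ((hw2.const_mul _).add (integrable_const _)) h1
      _ = (1 / (2 * W)) * ∫ x, w x ^ 2 ∂μ + W / 2 := by
          rw [integral_add (hw2.const_mul _) (integrable_const _), integral_const_mul]; simp
      _ ≤ (1 / (2 * W)) * W ^ 2 + W / 2 := by gcongr
      _ = W := by field_simp; ring
  let rep : Fin m → T := Function.invFun κ
  have hrep : ∀ t, κ (rep (κ t)) = κ t := fun t => Function.invFun_eq ⟨t, rfl⟩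
  let F : Fin m → E → ℝ := fun j x => w₁ x * h (rep j) x
  have hFm : ∀ j, AEStronglyMeasurable (F j) μ := fun j => hw₁m.mul (hmeas _)
  have hFb : ∀ j, ∀ᵐ x ∂μ, |F j x| ≤ T₀ * M := by
    intro j
    filter_upwards [hA] with x hx
    rw [abs_mul]
    exact mul_le_mul (abs_clip_le hT0.le _) (hhM _ x hx) (abs_nonneg _) hT0.le
  have hFi : ∀ j, Integrable (F j) μ := fun j =>
    Integrable.of_bound (hFm j) (T₀ * M) (by simpa using hFb j)
  have hFv : ∀ j, ∫ x, F j x ^ 2 ∂μ ≤ M ^ 2 * W ^ 2 := by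
    intro j
    calc ∫ x, F j x ^ 2 ∂μ ≤ ∫ x, M ^ 2 * w x ^ 2 ∂μ := by
          refine integral_mono_ae ?_ (hw2.const_mul _) ?_
          · refine Integrable.of_bound ((hFm j).pow 2) ((T₀ * M) ^ 2) ?_
            filter_upwards [hFb j] with x hx
            rw [Real.norm_eq_abs, abs_pow]
            exact pow_le_pow_left₀ (abs_nonneg _) hx 2
          · filter_upwards [hA] with x hx
            have h1 : |F j x| ≤ |M * w x| := by
              rw [abs_mul, abs_mul, mul_comm, abs_of_pos hM]
              exact mul_le_mul (hhM _ x hx) (abs_clip_le_abs hT0.le _) (abs_nonneg _) hM.le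
            have := sq_le_sq.2 h1
            simpa [mul_pow] using this
      _ = M ^ 2 * ∫ x, w x ^ 2 ∂μ := integral_const_mul _ _
      _ ≤ M ^ 2 * W ^ 2 := by gcongr
  have hrb : 2 * |r| * (T₀ * M) ≤ 1 := by
    rw [abs_of_pos hr0, hr, hT₀]
    apply le_of_eq; field_simp
  have hrb' : 2 * |-r| * (T₀ * M) ≤ 1 := by rwa [abs_neg]
  let D : Fin m → (Fin N → E) → ℝ := fun j X => ∑ k, (F j (X k) - ∫ x, F j x ∂μ)
  let Y : (Fin N → E) → ℝ := fun X => ∑ j, (Real.exp (r * D j X) + Real.exp (-r * D j X))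
  set q := Real.exp (N * (r ^ 2 * (M ^ 2 * W ^ 2))) with hq
  have hpos := fun j => integral_exp_sum_le N (hFm j) (hFb j) (hFv j) hrb
  have hneg := fun j => integral_exp_sum_le N (hFm j) (hFb j) (hFv j) hrb'
  have hYj : ∀ j, Integrable (fun X => Real.exp (r * D j X) + Real.exp (-r * D j X))
      (Measure.pi fun _ => μ) := fun j => (hpos j).1.add (hneg j).1
  have hYi : Integrable Y (Measure.pi fun _ => μ) := integrable_finsetSum _ fun j _ => hYj j
  have hYle : ∫ X, Y X ∂(Measure.pi fun _ => μ) ≤ 2 * m * q := by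
    rw [integral_finsetSum _ fun j _ => hYj j]
    calc _ ≤ ∑ _j : Fin m, (q + q) := by
          refine Finset.sum_le_sum fun j _ => ?_
          rw [integral_add (hpos j).1 (hneg j).1]
          refine add_le_add (hpos j).2 ((hneg j).2.trans ?_)
          rw [neg_sq]
      _ = 2 * m * q := by simp; ring
  set c := 2 * m * q with hc
  have hq0 : 0 < q := Real.exp_pos _
  have hc0 : 0 < c := by positivity
  have hlogc : Real.log c = lg + N * (r ^ 2 * (M ^ 2 * W ^ 2)) := by
    rw [hc, Real.log_mul (by positivity) hq0.ne', hq, Real.log_exp]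
  have hDY : ∀ j X, r * |D j X| ≤ Y X / c - 1 + Real.log c := by
    intro j X
    have h1 : Real.exp (r * |D j X|) ≤ Y X := by
      have h2 : Real.exp (r * |D j X|) ≤ Real.exp (r * D j X) + Real.exp (-r * D j X) := by
        rcases abs_choice (D j X) with h | h <;> rw [h]
        · linarith [Real.exp_pos (-r * D j X)]
        · rw [mul_neg, ← neg_mul]; linarith [Real.exp_pos (r * D j X)]
      refine h2.trans ?_
      exact Finset.single_le_sum (f := fun j => Real.exp (r * D j X) + Real.exp (-r * D j X))
        (fun i _ => by positivity) (Finset.mem_univ j)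
    have hY0 : 0 < Y X := (Real.exp_pos _).trans_le h1
    have h3 : r * |D j X| ≤ Real.log (Y X) := (Real.le_log_iff_exp_le hY0).2 h1
    have h4 := Real.log_le_sub_one_of_pos (div_pos hY0 hc0)
    rw [Real.log_div hY0.ne' hc0.ne'] at h4
    linarith
  let ψ : E → ℝ := fun x => ε * |w x| + M * (w x ^ 2 / T₀)
  have hψi : Integrable ψ μ := (hwi.abs.const_mul _).add ((hw2.div_const _).const_mul _)
  have hψle : ∫ x, ψ x ∂μ ≤ ε * W + M * (W ^ 2 / T₀) := by
    rw [integral_add (hwi.abs.const_mul _) ((hw2.div_const _).const_mul _), integral_const_mul,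
      integral_const_mul, integral_div]
    gcongr
  have hrem : ∀ t, ∀ x ∈ A, |w x * h t x - F (κ t) x| ≤ ψ x := by
    intro t x hx
    have h1 : w x * h t x - F (κ t) x =
        w₁ x * (h t x - h (rep (κ t)) x) + (w x - w₁ x) * h t x := by
      simp only [F]; ring
    rw [h1]
    refine (abs_add_le _ _).trans ?_
    rw [abs_mul, abs_mul]
    have h2 : |h t x - h (rep (κ t)) x| ≤ ε := hκ _ _ (hrep t).symm x hx
    have h3 : |w₁ x| ≤ |w x| := abs_clip_le_abs hT0.le _
    have h4 : |w x - w₁ x| ≤ w x ^ 2 / T₀ := abs_sub_clip_le hT0 _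
    have h5 := hhM t x hx
    calc |w₁ x| * |h t x - h (rep (κ t)) x| + |w x - w₁ x| * |h t x|
        ≤ |w x| * ε + w x ^ 2 / T₀ * M := by gcongr
      _ = ψ x := by simp only [ψ]; ring
  have hAk : ∀ᵐ X ∂(Measure.pi fun _ : Fin N => μ), ∀ k, X k ∈ A := by
    rw [ae_all_iff]
    exact fun k => (Measure.quasiMeasurePreserving_eval (fun _ : Fin N => μ) k).ae hA
  have hψX : Integrable (fun X : Fin N → E => ∑ k, ψ (X k)) (Measure.pi fun _ => μ) :=
    integrable_finsetSum _ fun k _ => integrable_comp_eval (μ := fun _ : Fin N => μ) hψi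
  have hψXle : ∫ X : Fin N → E, ∑ k, ψ (X k) ∂(Measure.pi fun _ => μ) = N * ∫ x, ψ x ∂μ := by
    rw [integral_finsetSum _ fun k _ => integrable_comp_eval (μ := fun _ : Fin N => μ) hψi]
    have : ∀ k : Fin N, ∫ X : Fin N → E, ψ (X k) ∂(Measure.pi fun _ => μ) = ∫ x, ψ x ∂μ :=
      fun k => integral_comp_eval (μ := fun _ : Fin N => μ) hψi.aestronglyMeasurable
    simp [this]
  have hsum1 : Integrable (fun X : Fin N → E => 1 / (N : ℝ) * (∑ k, ψ (X k)) + ∫ x, ψ x ∂μ)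
      (Measure.pi fun _ => μ) := (hψX.const_mul _).add (integrable_const _)
  have hsum2 : Integrable (fun X => Y X / c - 1) (Measure.pi fun _ => μ) :=
    (hYi.div_const _).sub (integrable_const _)
  have hsum3 : Integrable (fun X => 1 / (N * r) * (Y X / c - 1 + Real.log c))
      (Measure.pi fun _ => μ) := (hsum2.add (integrable_const _)).const_mul _
  refine ⟨fun X => 1 / (N : ℝ) * (∑ k, ψ (X k)) + ∫ x, ψ x ∂μ +
    1 / (N * r) * (Y X / c - 1 + Real.log c), ?_, ?_, ?_⟩
  · exact hsum1.add hsum3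
  · filter_upwards [hAk] with X hX t
    have hwh : Integrable (fun x => w x * h t x) μ :=
      hwi.mul_bdd (hmeas t) (by filter_upwards [hA] with x hx using hhM t x hx)
    have hsplit : 1 / (N : ℝ) * ∑ k, w (X k) * h t (X k) - ∫ x, w x * h t x ∂μ =
        1 / (N : ℝ) * (∑ k, (w (X k) * h t (X k) - F (κ t) (X k)))
          - (∫ x, (w x * h t x - F (κ t) x) ∂μ) + 1 / N * D (κ t) X := by
      rw [integral_sub hwh (hFi _)]
      simp only [D, Finset.sum_sub_distrib, Finset.sum_const, Finset.card_univ, Fintype.card_fin,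
        nsmul_eq_mul]
      field_simp
      ring
    rw [hsplit]
    have h1 : |1 / (N : ℝ) * (∑ k, (w (X k) * h t (X k) - F (κ t) (X k)))| ≤
        1 / (N : ℝ) * ∑ k, ψ (X k) := by
      rw [abs_mul, abs_of_pos (by positivity : 0 < 1 / (N : ℝ))]
      refine mul_le_mul_of_nonneg_left ?_ (by positivity)
      exact (Finset.abs_sum_le_sum_abs _ _).trans
        (Finset.sum_le_sum fun k _ => hrem t _ (hX k))
    have h2 : |∫ x, (w x * h t x - F (κ t) x) ∂μ| ≤ ∫ x, ψ x ∂μ := by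
      refine (abs_integral_le_integral_abs).trans ?_
      refine integral_mono_ae (hwh.sub (hFi _)).abs hψi ?_
      filter_upwards [hA] with x hx using hrem t x hx
    have h3 : |1 / (N : ℝ) * D (κ t) X| ≤ 1 / (N * r) * (Y X / c - 1 + Real.log c) := by
      rw [abs_mul, abs_of_pos (by positivity : 0 < 1 / (N : ℝ))]
      calc 1 / (N : ℝ) * |D (κ t) X| = 1 / (N * r) * (r * |D (κ t) X|) := by field_simp
        _ ≤ _ := mul_le_mul_of_nonneg_left (hDY _ _) (by positivity)
    exact (abs_add_le _ _).trans (add_le_add ((abs_sub _ _).trans (add_le_add h1 h2)) h3)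
  · rw [integral_add hsum1 hsum3, integral_add (hψX.const_mul _) (integrable_const _),
      integral_const_mul, hψXle, integral_const_mul, integral_add hsum2 (integrable_const _),
      integral_sub (hYi.div_const _) (integrable_const _), integral_div]
    simp only [integral_const, probReal_univ, one_smul]
    have h1 : (∫ X, Y X ∂(Measure.pi fun _ => μ)) / c ≤ 1 := (div_le_one hc0).2 hYle
    calc _ ≤ 1 / (N : ℝ) * (N * (ε * W + M * (W ^ 2 / T₀))) + (ε * W + M * (W ^ 2 / T₀)) +
          1 / (N * r) * (1 - 1 + Real.log c) := by gcongr
      _ = 2 * (ε * W) + 4 * (M * W * σ) + M * W * ((lg / N) / σ + σ) := by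
          rw [hlogc, hT₀, hr]; field_simp; ring
      _ = W * (2 * ε + 6 * M * σ) := by
          rw [← hσ2]; field_simp; ring

end Concentration

/-! ### Closeness in `C¹` of the unit cube and cells -/

section Jets

variable {d : ℕ}

/-- The closed unit cube. -/
def unitCube (d : ℕ) : Set (Sp d) := {x | ∀ i, 0 ≤ x i ∧ x i ≤ 1}

/-- `u` and `v` are `ε`-close in `C¹` on the unit cube. -/
def JetClose (ε : ℝ) (u v : Sp d → ℝ) : Prop :=
  ∀ x ∈ unitCube d, |u x - v x| ≤ ε ∧ ∀ i, |pd i u x - pd i v x| ≤ ε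

theorem JetClose.mono {ε ε' : ℝ} {u v : Sp d → ℝ} (h : JetClose ε u v) (hε : ε ≤ ε') :
    JetClose ε' u v :=
  fun x hx => ⟨(h x hx).1.trans hε, fun i => ((h x hx).2 i).trans hε⟩

/-- The class `H` can be divided into `m` cells each of which has `C¹`-diameter at most `ε` on the
unit cube; `κ u` is the number of the cell of `u`. -/
def HasCells (H : Set (Sp d → ℝ)) (ε : ℝ) (m : ℕ) : Prop :=
  ∃ κ : (Sp d → ℝ) → Fin m, ∀ u ∈ H, ∀ v ∈ H, κ u = κ v → JetClose ε u v

theorem HasCells.mono {H H' : Set (Sp d → ℝ)} {ε ε' : ℝ} {m : ℕ} (h : HasCells H ε m)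
    (hH : H' ⊆ H) (hε : ε ≤ ε') : HasCells H' ε' m := by
  obtain ⟨κ, hκ⟩ := h
  exact ⟨κ, fun u hu v hv huv => (hκ u (hH hu) v (hH hv) huv).mono hε⟩

/-- Cells of a parametrized class, from a finite code for the parameters. -/
theorem HasCells.of_param {H : Set (Sp d → ℝ)} {ε : ℝ} {T γ : Type*} [Fintype γ] [Nonempty γ]
    (valid : T → Prop) (e : T → Sp d → ℝ) (code : T → γ)
    (hsurj : ∀ u ∈ H, ∃ t, valid t ∧ e t = u)
    (hclose : ∀ s t, valid s → valid t → code s = code t → JetClose ε (e s) (e t)) :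
    HasCells H ε (Fintype.card γ) := by
  classical
  refine ⟨fun u => Fintype.equivFin γ
    (if h : ∃ t, valid t ∧ e t = u then code h.choose else Classical.arbitrary γ), ?_⟩
  intro u hu v hv huv
  have hu' := hsurj u hu
  have hv' := hsurj v hv
  have h1 := (Fintype.equivFin γ).injective huv
  rw [dif_pos hu', dif_pos hv'] at h1
  have h2 := hclose _ _ hu'.choose_spec.1 hv'.choose_spec.1 h1
  rwa [hu'.choose_spec.2, hv'.choose_spec.2] at h2

/-- A grid for the weights in `[-B, B]`. -/
theorem exists_grid (B : ℝ) {δ : ℝ} (hδ : 0 < δ) :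
    ∃ γ : ℝ → Fin (⌊2 * B / δ⌋₊ + 1), ∀ a a', |a| ≤ B → |a'| ≤ B → γ a = γ a' →
      |a - a'| ≤ δ := by
  refine ⟨fun a => Fin.ofNat _ ⌊(a + B) / δ⌋₊, ?_⟩
  intro a a' ha ha' h
  have key : ∀ a : ℝ, |a| ≤ B → 0 ≤ (a + B) / δ ∧ ⌊(a + B) / δ⌋₊ < ⌊2 * B / δ⌋₊ + 1 := by
    intro a ha
    have := abs_le.1 ha
    refine ⟨div_nonneg (by linarith) hδ.le, Nat.lt_succ_of_le (Nat.floor_mono ?_)⟩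
    gcongr; linarith
  have h1 := congrArg Fin.val h
  simp only [Fin.ofNat, Nat.mod_eq_of_lt (key a ha).2, Nat.mod_eq_of_lt (key a' ha').2] at h1
  have e1 := Nat.floor_le (key a ha).1
  have e2 := Nat.lt_floor_add_one ((a + B) / δ)
  have e3 := Nat.floor_le (key a' ha').1
  have e4 := Nat.lt_floor_add_one ((a' + B) / δ)
  rw [h1] at e1 e2
  have h3 : |(a + B) / δ - (a' + B) / δ| ≤ 1 := by rw [abs_le]; constructor <;> linarith
  have h4 : (a + B) / δ - (a' + B) / δ = (a - a') / δ := by ring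
  rw [h4, abs_div, abs_of_pos hδ, div_le_one hδ] at h3
  exact h3

theorem pd_add_const (i : Fin d) (u : Sp d → ℝ) (b : ℝ) (x : Sp d) :
    pd i (fun y => u y + b) x = pd i u x := by
  simp [pd, fderiv_add_const]

theorem pd_linear_comb {n : ℕ} (i : Fin d) (a : Fin n → ℝ) (b : ℝ) {h : Fin n → Sp d → ℝ}
    {x : Sp d} (hh : ∀ j, DifferentiableAt ℝ (h j) x) :
    pd i (fun y => (∑ j, a j * h j y) + b) x = ∑ j, a j * pd i (h j) x := by
  rw [pd_add_const]
  simp only [pd]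
  rw [fderiv_fun_sum fun j _ => (hh j).const_mul (a j)]
  simp [fderiv_const_mul (hh _)]

theorem pd_coord (i j : Fin d) (x : Sp d) : pd i (fun y : Sp d => y j) x = if j = i then 1 else 0 := by
  have : (fun y : Sp d => y j) = (EuclideanSpace.proj j : Sp d →L[ℝ] ℝ) := by ext y; simp
  simp only [pd, this, ContinuousLinearMap.fderiv]
  simp

theorem pd_comp {ρ : ℝ → ℝ} (hρ : Differentiable ℝ ρ) (i : Fin d) {u : Sp d → ℝ} {x : Sp d}
    (hu : DifferentiableAt ℝ u x) :
    pd i (fun y => ρ (u y)) x = deriv ρ (u x) * pd i u x := by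
  have := ((hρ (u x)).hasDerivAt.comp_hasFDerivAt x hu.hasFDerivAt).fderiv
  simp only [pd]
  change fderiv ℝ (ρ ∘ u) x _ = _
  rw [this]; simp

theorem pd_const (i : Fin d) (b : ℝ) (x : Sp d) : pd i (fun _ => b) x = 0 := by
  simp [pd]

theorem continuous_pd (i : Fin d) {u : Sp d → ℝ} (hu : ContDiff ℝ 1 u) : Continuous (pd i u) :=
  (hu.continuous_fderiv one_ne_zero).clm_apply continuous_const

end Jets

/-! ### Cells of network classes -/

section Networks

/-- The properties of the activation function that are used. -/
structure IsActivation (ρ : ℝ → ℝ) : Prop where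
  differentiable : Differentiable ℝ ρ
  abs_le : ∀ t, |ρ t| ≤ 1
  abs_deriv_le : ∀ t, |deriv ρ t| ≤ 1
  lipschitz : LipschitzWith 1 ρ
  lipschitz_deriv : LipschitzWith 1 (deriv ρ)

theorem IsActivation.contDiff {ρ : ℝ → ℝ} (hρ : IsActivation ρ) : ContDiff ℝ 1 ρ :=
  contDiff_one_iff_deriv.2 ⟨hρ.differentiable, hρ.lipschitz_deriv.continuous⟩

theorem IsActivation.abs_sub_le {ρ : ℝ → ℝ} (hρ : IsActivation ρ) (s t : ℝ) :
    |ρ s - ρ t| ≤ |s - t| := by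
  simpa [Real.dist_eq] using hρ.lipschitz.dist_le_mul s t

theorem IsActivation.abs_deriv_sub_le {ρ : ℝ → ℝ} (hρ : IsActivation ρ) (s t : ℝ) :
    |deriv ρ s - deriv ρ t| ≤ |s - t| := by
  simpa [Real.dist_eq] using hρ.lipschitz_deriv.dist_le_mul s t

/-- `C¹` functions whose partial derivatives are bounded by `G`. -/
def GradBounded {d : ℕ} (G : ℝ) (u : Sp d → ℝ) : Prop :=
  ContDiff ℝ 1 u ∧ ∀ i x, |pd i u x| ≤ G

/-- Affine functions with coefficients in `[-B, B]`: the networks with one layer. -/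
def affineClass (d : ℕ) (B : ℝ) : Set (Sp d → ℝ) :=
  {u | ∃ (a : Fin d → ℝ) (b : ℝ), (∀ i, |a i| ≤ B) ∧ |b| ≤ B ∧
    u = fun x => (∑ i, a i * x i) + b}

/-- Affine combinations of `n` members of `H` with coefficients in `[-B, B]`. -/
def outClass {d : ℕ} (n : ℕ) (B : ℝ) (H : Set (Sp d → ℝ)) : Set (Sp d → ℝ) :=
  {u | ∃ (a : Fin n → ℝ) (b : ℝ) (h : Fin n → Sp d → ℝ), (∀ j, |a j| ≤ B) ∧ |b| ≤ B ∧
    (∀ j, h j ∈ H) ∧ u = fun x => (∑ j, a j * h j x) + b}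

/-- The functions computed by a neuron in hidden layer `l + 1`, when a neuron outside the first
layer has at most `n` nonzero incoming weights.  The neurons of the preceding layer are not shared:
the network is unfolded into a tree, so that widths play no role. -/
def neuronClass (d : ℕ) (ρ : ℝ → ℝ) (n : ℕ) (B : ℝ) : ℕ → Set (Sp d → ℝ)
  | 0 => (fun u x => ρ (u x)) '' affineClass d B
  | l + 1 => (fun u x => ρ (u x)) '' outClass n B (neuronClass d ρ n B l)

variable {d : ℕ} {ρ : ℝ → ℝ}

theorem contDiff_coord (j : Fin d) : ContDiff ℝ 1 (fun y : Sp d => y j) :=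
  (EuclideanSpace.proj j : Sp d →L[ℝ] ℝ).contDiff

theorem gradBounded_of_mem_affineClass {B : ℝ} {u : Sp d → ℝ} (hu : u ∈ affineClass d B) :
    GradBounded B u := by
  obtain ⟨a, b, ha, hb, rfl⟩ := hu
  refine ⟨(ContDiff.sum fun i _ => contDiff_const.mul (contDiff_coord i)).add contDiff_const, ?_⟩
  intro i x
  rw [pd_linear_comb i a b (h := fun j y => y j)
    fun j => (contDiff_coord j).differentiable one_ne_zero x]
  simpa [pd_coord] using ha i

theorem abs_le_of_mem_affineClass {B : ℝ} {u : Sp d → ℝ} (hu : u ∈ affineClass d B) (x : Sp d) :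
    |u x| ≤ B * (1 + ∑ i, |x i|) := by
  obtain ⟨a, b, ha, hb, rfl⟩ := hu
  have h1 : |∑ i, a i * x i| ≤ ∑ i, B * |x i| :=
    (Finset.abs_sum_le_sum_abs _ _).trans (Finset.sum_le_sum fun i _ => by
      rw [abs_mul]; exact mul_le_mul_of_nonneg_right (ha i) (abs_nonneg _))
  rw [← Finset.mul_sum] at h1
  have h2 := abs_add_le (∑ i, a i * x i) b
  simp only
  linarith

theorem gradBounded_of_mem_outClass {n : ℕ} {B G : ℝ} {H : Set (Sp d → ℝ)}
    (hB : 0 ≤ B) (hH : ∀ h ∈ H, GradBounded G h) {u : Sp d → ℝ} (hu : u ∈ outClass n B H) :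
    GradBounded (n * B * G) u := by
  obtain ⟨a, b, h, ha, hb, hh, rfl⟩ := hu
  refine ⟨(ContDiff.sum fun j _ => contDiff_const.mul (hH _ (hh j)).1).add contDiff_const, ?_⟩
  intro i x
  rw [pd_linear_comb i a b fun j => (hH _ (hh j)).1.differentiable one_ne_zero x]
  calc |∑ j, a j * pd i (h j) x| ≤ ∑ _j : Fin n, B * G :=
        (Finset.abs_sum_le_sum_abs _ _).trans (Finset.sum_le_sum fun j _ => by
          rw [abs_mul]; exact mul_le_mul (ha j) ((hH _ (hh j)).2 i x) (abs_nonneg _) hB)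
    _ = n * B * G := by simp; ring

theorem abs_le_of_mem_outClass {n : ℕ} {B : ℝ} {H : Set (Sp d → ℝ)} (hB : 0 ≤ B)
    (hH : ∀ h ∈ H, ∀ x, |h x| ≤ 1) {u : Sp d → ℝ} (hu : u ∈ outClass n B H) (x : Sp d) :
    |u x| ≤ (n + 1) * B := by
  obtain ⟨a, b, h, ha, hb, hh, rfl⟩ := hu
  have h1 : |∑ j, a j * h j x| ≤ ∑ _j : Fin n, B * 1 :=
    (Finset.abs_sum_le_sum_abs _ _).trans (Finset.sum_le_sum fun j _ => by
      rw [abs_mul]; exact mul_le_mul (ha j) (hH _ (hh j) x) (abs_nonneg _) hB)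
  have h2 := abs_add_le (∑ j, a j * h j x) b
  simp only [Finset.sum_const, Finset.card_univ, Fintype.card_fin, nsmul_eq_mul, mul_one] at h1
  simp only
  linarith

theorem GradBounded.comp (hρ : IsActivation ρ) {G : ℝ} {u : Sp d → ℝ} (hu : GradBounded G u) :
    GradBounded G (fun x => ρ (u x)) := by
  refine ⟨hρ.contDiff.comp hu.1, fun i x => ?_⟩
  rw [pd_comp hρ.differentiable i (hu.1.differentiable one_ne_zero x), abs_mul]
  calc _ ≤ 1 * |pd i u x| := mul_le_mul_of_nonneg_right (hρ.abs_deriv_le _) (abs_nonneg _)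
    _ ≤ G := by rw [one_mul]; exact hu.2 i x

theorem abs_le_of_mem_neuronClass (hρ : IsActivation ρ) {n : ℕ} {B : ℝ} (l : ℕ) {u : Sp d → ℝ}
    (hu : u ∈ neuronClass d ρ n B l) (x : Sp d) : |u x| ≤ 1 := by
  cases l <;> obtain ⟨v, -, rfl⟩ := hu <;> exact hρ.abs_le _

theorem gradBounded_of_mem_neuronClass (hρ : IsActivation ρ) {n : ℕ} {B : ℝ} (hB : 0 ≤ B) (l : ℕ) :
    ∀ u ∈ neuronClass d ρ n B l, GradBounded ((n : ℝ) ^ l * B ^ (l + 1)) u := by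
  induction l with
  | zero =>
    rintro _ ⟨v, hv, rfl⟩
    simpa using (gradBounded_of_mem_affineClass hv).comp hρ
  | succ l ih =>
    rintro _ ⟨v, hv, rfl⟩
    have := (gradBounded_of_mem_outClass hB ih hv).comp hρ
    convert this using 1
    ring

/-- The cells of the affine functions are those of a grid for their `d + 1` coefficients. -/
theorem hasCells_affineClass {B δ : ℝ} (hδ : 0 < δ) :
    HasCells (affineClass d B) ((d + 1) * δ) ((⌊2 * B / δ⌋₊ + 1) ^ (d + 1)) := by
  obtain ⟨γ, hγ⟩ := exists_grid B hδ
  have := HasCells.of_param (H := affineClass d B) (ε := (d + 1) * δ)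
    (T := (Fin d → ℝ) × ℝ) (γ := (Fin d → Fin (⌊2 * B / δ⌋₊ + 1)) × Fin (⌊2 * B / δ⌋₊ + 1))
    (fun t => (∀ i, |t.1 i| ≤ B) ∧ |t.2| ≤ B)
    (fun t x => (∑ i, t.1 i * x i) + t.2) (fun t => (fun i => γ (t.1 i), γ t.2)) ?_ ?_
  · simpa [pow_succ] using this
  · rintro u ⟨a, b, ha, hb, rfl⟩
    exact ⟨(a, b), ⟨ha, hb⟩, rfl⟩
  · rintro ⟨a, b⟩ ⟨a', b'⟩ ⟨ha, hb⟩ ⟨ha', hb'⟩ h x hx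
    simp only [Prod.mk.injEq, funext_iff] at h
    have h1 : ∀ i, |a i - a' i| ≤ δ := fun i => hγ _ _ (ha i) (ha' i) (h.1 i)
    have h2 : |b - b'| ≤ δ := hγ _ _ hb hb' h.2
    constructor
    · have e : (∑ i, a i * x i) + b - ((∑ i, a' i * x i) + b') =
          (∑ i, (a i - a' i) * x i) + (b - b') := by
        simp only [sub_mul, Finset.sum_sub_distrib]; ring
      have h3 : |∑ i, (a i - a' i) * x i| ≤ ∑ _i : Fin d, δ * 1 :=
        (Finset.abs_sum_le_sum_abs _ _).trans (Finset.sum_le_sum fun i _ => by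
          rw [abs_mul, abs_of_nonneg (hx i).1]
          exact mul_le_mul (h1 i) (hx i).2 (hx i).1 hδ.le)
      have h4 := abs_add_le (∑ i, (a i - a' i) * x i) (b - b')
      simp only [Finset.sum_const, Finset.card_univ, Fintype.card_fin, nsmul_eq_mul, mul_one] at h3
      simp only [e]
      linarith
    · intro i
      rw [pd_linear_comb i a b (h := fun j y => y j)
        fun j => (contDiff_coord j).differentiable one_ne_zero x,
        pd_linear_comb i a' b' (h := fun j y => y j)
        fun j => (contDiff_coord j).differentiable one_ne_zero x]
      simp only [pd_coord, mul_ite, mul_one, mul_zero, Finset.sum_ite_eq', Finset.mem_univ, if_true]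
      have : (0 : ℝ) ≤ d * δ := by positivity
      linarith [h1 i]

/-- A cell of an affine combination consists of grid cells for the coefficients and of a cell for
each of the functions that are combined. -/
theorem hasCells_outClass {n m : ℕ} {B G ε δ : ℝ} {H : Set (Sp d → ℝ)} (hB : 0 ≤ B) (hG : 1 ≤ G)
    (hδ : 0 < δ) (hH : ∀ h ∈ H, GradBounded G h) (hH1 : ∀ h ∈ H, ∀ x, |h x| ≤ 1)
    (hc : HasCells H ε m) :
    HasCells (outClass n B H) (n * (B * ε + δ * G) + δ)
      (((⌊2 * B / δ⌋₊ + 1) * m) ^ n * (⌊2 * B / δ⌋₊ + 1)) := by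
  obtain ⟨γ, hγ⟩ := exists_grid B hδ
  obtain ⟨κ, hκ⟩ := hc
  have : Nonempty (Fin m) := ⟨κ fun _ => 0⟩
  have := HasCells.of_param (H := outClass n B H) (ε := n * (B * ε + δ * G) + δ)
    (T := (Fin n → ℝ × (Sp d → ℝ)) × ℝ)
    (γ := (Fin n → Fin (⌊2 * B / δ⌋₊ + 1) × Fin m) × Fin (⌊2 * B / δ⌋₊ + 1))
    (fun t => (∀ j, |(t.1 j).1| ≤ B ∧ (t.1 j).2 ∈ H) ∧ |t.2| ≤ B)
    (fun t x => (∑ j, (t.1 j).1 * (t.1 j).2 x) + t.2)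
    (fun t => (fun j => (γ (t.1 j).1, κ (t.1 j).2), γ t.2)) ?_ ?_
  · simpa using this
  · rintro u ⟨a, b, h, ha, hb, hh, rfl⟩
    exact ⟨(fun j => (a j, h j), b), ⟨fun j => ⟨ha j, hh j⟩, hb⟩, rfl⟩
  · rintro ⟨s, b⟩ ⟨s', b'⟩ ⟨hs, hb⟩ ⟨hs', hb'⟩ h x hx
    simp only [Prod.mk.injEq, funext_iff] at h
    simp only at hs hs' hb hb'
    have h1 : ∀ j, |(s j).1 - (s' j).1| ≤ δ := fun j => hγ _ _ (hs j).1 (hs' j).1 (h.1 j).1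
    have h2 : |b - b'| ≤ δ := hγ _ _ hb hb' h.2
    have h3 : ∀ j, JetClose ε (s j).2 (s' j).2 := fun j =>
      hκ _ (hs j).2 _ (hs' j).2 (h.1 j).2
    have key : ∀ j (y y' : ℝ), |y - y'| ≤ ε → |y'| ≤ G →
        |(s j).1 * y - (s' j).1 * y'| ≤ B * ε + δ * G := by
      intro j y y' hy hy'
      have e : (s j).1 * y - (s' j).1 * y' = (s j).1 * (y - y') + ((s j).1 - (s' j).1) * y' := by
        ring
      rw [e]
      refine (abs_add_le _ _).trans ?_
      rw [abs_mul, abs_mul]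
      exact add_le_add (mul_le_mul (hs j).1 hy (abs_nonneg _) hB)
        (mul_le_mul (h1 j) hy' (abs_nonneg _) hδ.le)
    have hsum : ∀ y y' : Fin n → ℝ, (∀ j, |y j - y' j| ≤ ε) → (∀ j, |y' j| ≤ G) →
        |(∑ j, (s j).1 * y j) - ∑ j, (s' j).1 * y' j| ≤ n * (B * ε + δ * G) := by
      intro y y' hy hy'
      rw [← Finset.sum_sub_distrib]
      refine (Finset.abs_sum_le_sum_abs _ _).trans
        ((Finset.sum_le_sum fun j _ => key j _ _ (hy j) (hy' j)).trans (le_of_eq ?_))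
      rw [Finset.sum_const, Finset.card_univ, Fintype.card_fin, nsmul_eq_mul]
    constructor
    · have h4 := hsum (fun j => (s j).2 x) (fun j => (s' j).2 x) (fun j => (h3 j x hx).1)
        fun j => (hH1 _ (hs' j).2 x).trans hG
      have e : (∑ j, (s j).1 * (s j).2 x) + b - ((∑ j, (s' j).1 * (s' j).2 x) + b') =
          ((∑ j, (s j).1 * (s j).2 x) - ∑ j, (s' j).1 * (s' j).2 x) + (b - b') := by ring
      simp only [e]
      exact (abs_add_le _ _).trans (add_le_add h4 h2)
    · intro i
      rw [pd_linear_comb i (fun j => (s j).1) b (h := fun j => (s j).2)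
        fun j => (hH _ (hs j).2).1.differentiable one_ne_zero x,
        pd_linear_comb i (fun j => (s' j).1) b' (h := fun j => (s' j).2)
        fun j => (hH _ (hs' j).2).1.differentiable one_ne_zero x]
      have h4 := hsum (fun j => pd i (s j).2 x) (fun j => pd i (s' j).2 x)
        (fun j => (h3 j x hx).2 i) fun j => (hH _ (hs' j).2).2 i x
      linarith

/-- The activation carries cells to cells; as its derivative is Lipschitz, so are the gradients
after composition, with a constant that depends on their size. -/
theorem HasCells.comp (hρ : IsActivation ρ) {m : ℕ} {G η : ℝ} {H : Set (Sp d → ℝ)} (hη : 0 ≤ η)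
    (hG : 0 ≤ G) (hH : ∀ h ∈ H, GradBounded G h) (hc : HasCells H η m) :
    HasCells ((fun u x => ρ (u x)) '' H) (η * (1 + G)) m := by
  obtain ⟨κ, hκ⟩ := hc
  have : Nonempty (Fin m) := ⟨κ fun _ => 0⟩
  have := HasCells.of_param (H := (fun u x => ρ (u x)) '' H) (ε := η * (1 + G))
    (T := Sp d → ℝ) (γ := Fin m) (fun u => u ∈ H) (fun u x => ρ (u x)) κ ?_ ?_
  · simpa using this
  · rintro _ ⟨u, hu, rfl⟩
    exact ⟨u, hu, rfl⟩
  · intro u v hu hv huv x hx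
    have h1 := hκ u hu v hv huv x hx
    have hηG : 0 ≤ η * G := mul_nonneg hη hG
    constructor
    · exact (hρ.abs_sub_le _ _).trans (by linarith [h1.1])
    · intro i
      rw [pd_comp hρ.differentiable i ((hH u hu).1.differentiable one_ne_zero x),
        pd_comp hρ.differentiable i ((hH v hv).1.differentiable one_ne_zero x)]
      have e : deriv ρ (u x) * pd i u x - deriv ρ (v x) * pd i v x =
        (deriv ρ (u x) - deriv ρ (v x)) * pd i u x + deriv ρ (v x) * (pd i u x - pd i v x) := by
        ring
      rw [e]
      refine (abs_add_le _ _).trans ?_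
      rw [abs_mul, abs_mul]
      calc _ ≤ η * G + 1 * η := add_le_add
            (mul_le_mul ((hρ.abs_deriv_sub_le _ _).trans h1.1) ((hH u hu).2 i x) (abs_nonneg _) hη)
            (mul_le_mul (hρ.abs_deriv_le _) (h1.2 i) (abs_nonneg _) zero_le_one)
        _ = η * (1 + G) := by ring

/-- The number of weights of a neuron of `neuronClass` after unfolding. -/
def treeSize (d n : ℕ) : ℕ → ℕ
  | 0 => d + 1
  | l + 1 => n * (treeSize d n l + 1) + 1

/-- The shift by `3` turns the recursion for `treeSize` into a geometric inequality. -/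
theorem treeSize_le (d : ℕ) {n : ℕ} (hn : 2 ≤ n) (l : ℕ) :
    treeSize d n l + 3 ≤ n ^ l * (d + 4) := by
  induction l with
  | zero => simp [treeSize]
  | succ l ih =>
    calc treeSize d n (l + 1) + 3 ≤ n * (treeSize d n l + 3) := by
          simp only [treeSize]; nlinarith
      _ ≤ n * (n ^ l * (d + 4)) := Nat.mul_le_mul_left _ ih
      _ = n ^ (l + 1) * (d + 4) := by ring

/-- One step of the recursion for the diameters of the cells. -/
theorem cellWidth_step {n B G L δ : ℝ} (hn : 1 ≤ n) (hB : 1 ≤ B) (hG : 1 ≤ G) (hGL : G ≤ L)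
    (hδ : 0 < δ) : n * (B * (L * δ) + δ * G) + δ ≤ 3 * (n * B * L) * δ := by
  have h1 : n * G ≤ n * B * L := by
    calc n * G ≤ n * L := by gcongr
      _ ≤ n * B * L := by rw [mul_assoc]; gcongr; nlinarith
  have h2 : 1 ≤ n * G := by nlinarith
  have h3 := mul_le_mul_of_nonneg_right h1 hδ.le
  have h4 := mul_le_mul_of_nonneg_right h2 hδ.le
  nlinarith

/-- The cells of the network classes.  With a grid of mesh `δ` for all weights of the unfolded tree,
each layer multiplies the diameter by at most `6 (n B)² (n B) ^ (l + 1)`, which adds up to a power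
of `n B` with an exponent quadratic in the depth; only its logarithm matters. -/
theorem hasCells_neuronClass_outClass (hρ : IsActivation ρ) (hd : 1 ≤ d) {n : ℕ} (hn : 2 ≤ n)
    {B δ : ℝ} (hB : 1 ≤ B) (hδ : 0 < δ) (l : ℕ) :
    HasCells (neuronClass d ρ n B l) (3 * d * (n * B) ^ ((l + 6) ^ 2) * δ)
        ((⌊2 * B / δ⌋₊ + 1) ^ treeSize d n l) ∧
      HasCells (outClass n B (neuronClass d ρ n B l)) (3 * d * (n * B) ^ ((l + 7) ^ 2) * δ)
        ((⌊2 * B / δ⌋₊ + 1) ^ treeSize d n (l + 1)) := by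
  have hB0 : 0 ≤ B := by linarith
  have hn' : (2 : ℝ) ≤ n := by exact_mod_cast hn
  have hn1 : (1 : ℝ) ≤ n := by linarith
  have hd' : (1 : ℝ) ≤ d := by exact_mod_cast hd
  have hnB : 1 ≤ n * B := one_le_mul_of_one_le_of_one_le hn1 hB
  have hnB6 : 6 ≤ (n * B) ^ 3 := by
    have : (2 : ℝ) ≤ n * B := by nlinarith
    calc (6 : ℝ) ≤ 2 ^ 3 := by norm_num
      _ ≤ (n * B) ^ 3 := by gcongr
  have hG1 : ∀ l, 1 ≤ (n : ℝ) ^ l * B ^ (l + 1) := fun l =>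
    one_le_mul_of_one_le_of_one_le (one_le_pow₀ hn1) (one_le_pow₀ hB)
  have hGle : ∀ l, (n : ℝ) ^ l * B ^ (l + 1) ≤ (n * B) ^ (l + 1) := by
    intro l
    rw [mul_pow]
    gcongr
    omega
  have hGL : ∀ l, (n : ℝ) ^ l * B ^ (l + 1) ≤ 3 * d * (n * B) ^ ((l + 6) ^ 2) := by
    intro l
    refine (hGle l).trans ?_
    calc (n * B) ^ (l + 1) ≤ (n * B) ^ ((l + 6) ^ 2) := pow_le_pow_right₀ hnB (by nlinarith)
      _ ≤ 3 * d * (n * B) ^ ((l + 6) ^ 2) := le_mul_of_one_le_left (by positivity) (by linarith)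
  -- The recursion step for the affine combinations, before the activation is applied.
  have step : ∀ l, HasCells (neuronClass d ρ n B l) (3 * d * (n * B) ^ ((l + 6) ^ 2) * δ)
        ((⌊2 * B / δ⌋₊ + 1) ^ treeSize d n l) →
      HasCells (outClass n B (neuronClass d ρ n B l))
        (3 * (n * B * (3 * d * (n * B) ^ ((l + 6) ^ 2))) * δ)
        ((⌊2 * B / δ⌋₊ + 1) ^ treeSize d n (l + 1)) := by
    intro l h
    have h1 := hasCells_outClass (n := n) hB0 (hG1 l) hδ
      (gradBounded_of_mem_neuronClass hρ hB0 l)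
      (fun u hu x => abs_le_of_mem_neuronClass hρ l hu x) h
    have e : ((⌊2 * B / δ⌋₊ + 1) * (⌊2 * B / δ⌋₊ + 1) ^ treeSize d n l) ^ n *
        (⌊2 * B / δ⌋₊ + 1) = (⌊2 * B / δ⌋₊ + 1) ^ treeSize d n (l + 1) := by
      rw [← pow_succ', ← pow_mul, ← pow_succ]; simp only [treeSize]; ring_nf
    rw [e] at h1
    exact h1.mono subset_rfl (cellWidth_step hn1 hB (hG1 l) (hGL l) hδ)
  have main : ∀ l, HasCells (neuronClass d ρ n B l) (3 * d * (n * B) ^ ((l + 6) ^ 2) * δ)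
        ((⌊2 * B / δ⌋₊ + 1) ^ treeSize d n l) := by
    intro l
    induction l with
    | zero =>
      have h1 := (hasCells_affineClass (d := d) (B := B) hδ).comp hρ (by positivity) hB0
        fun u hu => gradBounded_of_mem_affineClass hu
      refine h1.mono subset_rfl ?_
      have h2 : 2 * B ≤ (n * B) ^ ((0 + 6) ^ 2) := by
        calc 2 * B ≤ n * B := by gcongr
          _ ≤ _ := le_self_pow₀ hnB (by norm_num)
      have h3 : ((d : ℝ) + 1) * (1 + B) ≤ 3 * d * (2 * B) := by nlinarith
      calc ((d : ℝ) + 1) * δ * (1 + B) = ((d + 1) * (1 + B)) * δ := by ring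
        _ ≤ (3 * d * (2 * B)) * δ := by gcongr
        _ ≤ (3 * d * (n * B) ^ ((0 + 6) ^ 2)) * δ := by gcongr
    | succ l ih =>
      have h1 := (step l ih).comp hρ (by positivity)
        (G := n * B * ((n : ℝ) ^ l * B ^ (l + 1))) (by positivity)
        fun u hu => gradBounded_of_mem_outClass hB0 (gradBounded_of_mem_neuronClass hρ hB0 l) hu
      refine h1.mono subset_rfl ?_
      have h2 : n * B * ((n : ℝ) ^ l * B ^ (l + 1)) ≤ (n * B) ^ (l + 2) := by
        calc _ ≤ n * B * (n * B) ^ (l + 1) := by gcongr; exact hGle l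
          _ = _ := by ring
      have h3 : 1 ≤ (n * B : ℝ) ^ (l + 2) := one_le_pow₀ hnB
      calc _ ≤ 3 * (n * B * (3 * d * (n * B) ^ ((l + 6) ^ 2))) * δ *
            ((n * B) ^ (l + 2) + (n * B) ^ (l + 2)) := by gcongr
        _ = 3 * d * (6 * (n * B) ^ ((l + 6) ^ 2 + l + 3)) * δ := by ring
        _ ≤ 3 * d * ((n * B) ^ 3 * (n * B) ^ ((l + 6) ^ 2 + l + 3)) * δ := by gcongr
        _ ≤ 3 * d * (n * B) ^ ((l + 1 + 6) ^ 2) * δ := by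
            rw [← pow_add]
            gcongr
            nlinarith
  refine ⟨main l, (step l (main l)).mono subset_rfl ?_⟩
  have h3 : (n * B) * 3 ≤ (n * B) * (n * B) ^ 3 := by gcongr; linarith
  calc _ = 3 * d * ((n * B * 3) * (n * B) ^ ((l + 6) ^ 2)) * δ := by ring
    _ ≤ 3 * d * ((n * B * (n * B) ^ 3) * (n * B) ^ ((l + 6) ^ 2)) * δ := by gcongr
    _ = 3 * d * (n * B) ^ ((l + 6) ^ 2 + 4) * δ := by ring
    _ ≤ 3 * d * (n * B) ^ ((l + 7) ^ 2) * δ := by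
        have : (l + 7) ^ 2 = (l + 6) ^ 2 + 2 * l + 13 := by ring
        gcongr
        linarith

/-- An affine form with at most `n` nonzero coefficients in members of `H` belongs to
`outClass n B H`: the support is padded with zero coefficients. -/
theorem mem_outClass_of_ncard_le {n k : ℕ} {B : ℝ} (hB : 0 ≤ B) {H : Set (Sp d → ℝ)} (hk : 0 < k)
    {a : Fin k → ℝ} {b : ℝ} (ha : ∀ j, |a j| ≤ B) (hb : |b| ≤ B)
    (hn : Set.ncard {j | a j ≠ 0} ≤ n) {h : Fin k → Sp d → ℝ} (hh : ∀ j, h j ∈ H) :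
    (fun x => (∑ j, a j * h j x) + b) ∈ outClass n B H := by
  classical
  set s : Finset (Fin k) := Finset.univ.filter fun j => a j ≠ 0 with hs
  have hcard : Set.ncard {j | a j ≠ 0} = s.card := by
    rw [← Set.ncard_coe_finset]; simp [hs]
  rw [hcard] at hn
  obtain ⟨r, rfl⟩ := Nat.exists_eq_add_of_le hn
  let e : Fin s.card ≃ s := s.equivFin.symm
  refine ⟨Fin.append (fun j => a (e j)) (fun _ => 0), b,
    Fin.append (fun j => h (e j)) (fun _ => h ⟨0, hk⟩), ?_, hb, ?_, ?_⟩
  · intro j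
    refine Fin.addCases (fun j => ?_) (fun j => ?_) j
    · simpa using ha _
    · simpa using hB
  · intro j
    refine Fin.addCases (fun j => ?_) (fun j => ?_) j
    · simpa using hh _
    · simpa using hh _
  · funext x
    rw [Fin.sum_univ_add]
    simp only [Fin.append_left, Fin.append_right, zero_mul, Finset.sum_const_zero, add_zero]
    congr 1
    rw [Equiv.sum_comp e (fun j : s => a j * h j x), Finset.sum_coe_sort s (fun j => a j * h j x),
      hs, Finset.sum_filter]
    refine Finset.sum_congr rfl fun j _ => ?_
    by_cases hj : a j = 0 <;> simp [hj]

theorem ncard_row_le {n k : ℕ} (A : Matrix (Fin k) (Fin n) ℝ) (b : Fin k → ℝ) (q : Fin k) :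
    Set.ncard {j | A q j ≠ 0} ≤ layerNonzero A b := by
  refine le_trans ?_ (Nat.le_add_right _ _)
  refine Set.ncard_le_ncard_of_injOn (fun j => (q, j)) (fun j hj => hj) ?_ (Set.toFinite _)
  intro j _ j' _ h
  simpa using h

/-- A network whose inputs are neurons of layer `l + 1` is an affine combination of neurons, as many
layers further on as it has hidden layers. -/
theorem eval_mem_outClass {n : ℕ} {B : ℝ} (hB : 0 ≤ B) {k : ℕ} (Φ : Net k) (hk : 0 < k)
    (hn : Φ.numNonzero ≤ n) (hΦ : Φ.WeightsBounded B) (l : ℕ) {h : Fin k → Sp d → ℝ}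
    (hh : ∀ q, h q ∈ neuronClass d ρ n B l) :
    (fun x => Φ.eval ρ (fun q => h q x)) ∈
      outClass n B (neuronClass d ρ n B (l + (Φ.depth - 1))) := by
  induction Φ generalizing l with
  | output A b =>
    exact mem_outClass_of_ncard_le hB hk (hΦ.1 0) (hΦ.2 0) ((ncard_row_le A b 0).trans hn) hh
  | hidden hk' A b rest ih =>
    have hn1 : layerNonzero A b ≤ n := (Nat.le_add_right _ _).trans hn
    have h1 := ih hk' ((Nat.le_add_left _ _).trans hn) hΦ.2 (l + 1)
      (h := fun q x => ρ (affineMap A b (fun j => h j x) q)) fun q =>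
        ⟨_, mem_outClass_of_ncard_le hB hk (hΦ.1.1 q) (hΦ.1.2 q)
          ((ncard_row_le A b q).trans hn1) hh, rfl⟩
    have hd : 1 ≤ rest.depth := by cases rest <;> simp [Net.depth]
    have e : l + ((Net.hidden hk' A b rest).depth - 1) = l + 1 + (rest.depth - 1) := by
      simp only [Net.depth]; omega
    rw [e]
    exact h1

/-- Networks with one layer are affine. -/
theorem networkClass_one_subset {n : ℕ} {B : ℝ} :
    networkClass d ρ 1 n B ⊆ affineClass d B := by
  rintro u ⟨Φ, hD, -, hB, hu⟩
  cases Φ with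
  | output A b => exact ⟨A 0, b 0, hB.1 0, hB.2 0, funext hu⟩
  | hidden hk A b rest =>
    have : 1 ≤ rest.depth := by cases rest <;> simp [Net.depth]
    simp only [Net.depth] at hD
    omega

theorem networkClass_subset_outClass {n D : ℕ} {B : ℝ} (hB : 0 ≤ B) :
    networkClass d ρ (D + 2) n B ⊆ outClass n B (neuronClass d ρ n B D) := by
  rintro u ⟨Φ, hD, hn, hΦ, hu⟩
  cases Φ with
  | output A b => simp [Net.depth] at hD
  | hidden hk A b rest =>
    have h1 := eval_mem_outClass (ρ := ρ) hB rest hk ((Nat.le_add_left _ _).trans hn) hΦ.2 0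
      (h := fun q (x : Sp d) => ρ (affineMap A b (fun i => x i) q)) fun q =>
        ⟨_, ⟨A q, b q, hΦ.1.1 q, hΦ.1.2 q, rfl⟩, rfl⟩
    simp only [Net.depth] at hD
    have e : 0 + (rest.depth - 1) = D := by omega
    rw [e] at h1
    rwa [funext hu]

theorem eq_zero_of_layerNonzero {n k : ℕ} {A : Matrix (Fin k) (Fin n) ℝ} {b : Fin k → ℝ}
    (h : layerNonzero A b = 0) : (∀ q j, A q j = 0) ∧ ∀ q, b q = 0 := by
  have h1 := Nat.add_eq_zero_iff.1 h
  rw [Set.ncard_eq_zero, Set.ncard_eq_zero] at h1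
  constructor
  · intro q j
    by_contra hne
    exact Set.notMem_empty (q, j) (h1.1 ▸ hne)
  · intro q
    by_contra hne
    exact Set.notMem_empty q (h1.2 ▸ hne)

theorem eval_eq_zero {k : ℕ} (Φ : Net k) (h : Φ.numNonzero = 0) (z : Fin k → ℝ) :
    Φ.eval ρ z = 0 := by
  induction Φ with
  | output A b =>
    obtain ⟨hA, hb⟩ := eq_zero_of_layerNonzero h
    simp [Net.eval, affineMap, hA, hb]
  | hidden hk A b rest ih =>
    exact ih (Nat.add_eq_zero_iff.1 h).2 _

/-- A network with at least two layers and at most one nonzero weight is constant, as one of its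
layers vanishes. -/
theorem networkClass_one_weight_subset (hρ : IsActivation ρ) {D : ℕ} {B : ℝ} (hB : 0 ≤ B) :
    networkClass d ρ (D + 2) 1 B ⊆ affineClass d (2 * B) := by
  intro u hu
  have hbd : ∀ x, |u x| ≤ 2 * B := by
    intro x
    have := abs_le_of_mem_outClass hB (fun h hh x => abs_le_of_mem_neuronClass hρ _ hh x)
      (networkClass_subset_outClass hB hu) x
    norm_num at this
    exact this
  obtain ⟨c, hc⟩ : ∃ c, ∀ x, u x = c := by
    obtain ⟨Φ, hD, hn, -, hu⟩ := hu
    cases Φ with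
    | output A b => simp [Net.depth] at hD
    | hidden hk A b rest =>
      simp only [Net.numNonzero] at hn
      by_cases h0 : rest.numNonzero = 0
      · exact ⟨0, fun x => by rw [hu]; exact eval_eq_zero rest h0 _⟩
      · obtain ⟨hA, hb⟩ := eq_zero_of_layerNonzero (A := A) (b := b) (by omega)
        refine ⟨rest.eval ρ fun _ => ρ 0, fun x => ?_⟩
        rw [hu]
        simp [Net.eval, affineMap, hA, hb]
  refine ⟨fun _ => 0, c, fun _ => by simpa using hB, ?_, ?_⟩
  · rw [← hc 0]; exact hbd 0
  · funext x; simp [hc]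

end Networks

/-! ### The Galerkin functional as a sum of pairings -/

section Galerkin

variable {d : ℕ}

/-- The common shape of the Galerkin functional and of its empirical version: `I w h` stands for
the pairing of a weight `w` with `h` over the domain, and `J w h` for that over the boundary. -/
noncomputable def robinForm (p : Coeffs d) (α β : ℝ) (I J : (Sp d → ℝ) → (Sp d → ℝ) → ℝ) (u v : Sp d → ℝ) : ℝ :=
  (∑ i, ∑ j, I (p.a i j) fun x => pd i u x * pd j v x)
    + (∑ i, I (p.b i) fun x => pd i u x * v x)
    + I p.c (fun x => u x * v x)
    + α / β * J (fun _ => 1) (fun x => u x * v x)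
    - I p.f v
    - 1 / β * J p.g v

theorem galerkin_eq_robinForm (p : Coeffs d) (Ω : Set (Sp d)) (α β : ℝ) (u v : Sp d → ℝ) :
    galerkin p Ω α β u v = robinForm p α β (fun w h => ∫ x in Ω, w x * h x)
      (fun w h => ∫ y in frontier Ω, w y * h y ∂(surf d)) u v := by
  simp only [galerkin, robinForm, mul_assoc, one_mul]

theorem galerkinEmp_eq_robinForm (p : Coeffs d) (Ω : Set (Sp d)) (α β : ℝ) {N M : ℕ}
    (X : Fin N → Sp d) (Y : Fin M → Sp d) (u v : Sp d → ℝ) :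
    galerkinEmp p Ω α β X Y u v = robinForm p α β
      (fun w h => volume.real Ω / N * ∑ k, w (X k) * h (X k))
      (fun w h => (surf d).real (frontier Ω) / M * ∑ k, w (Y k) * h (Y k)) u v := by
  have e1 : ∀ F : Fin d → Fin d → Fin N → ℝ, (∑ k, ∑ i, ∑ j, F i j k) = ∑ i, ∑ j, ∑ k, F i j k := by
    intro F
    rw [Finset.sum_comm]
    exact Finset.sum_congr rfl fun i _ => Finset.sum_comm
  have e2 : ∀ F : Fin d → Fin N → ℝ, (∑ k, ∑ i, F i k) = ∑ i, ∑ k, F i k :=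
    fun F => Finset.sum_comm
  simp only [galerkinEmp, robinForm, Finset.sum_sub_distrib, Finset.sum_add_distrib, mul_assoc,
    one_mul, e1, e2, ← Finset.mul_sum]
  rw [← div_div]
  ring

theorem abs_robinForm_sub_le (p : Coeffs d) (α β : ℝ) {I J I' J' : (Sp d → ℝ) → (Sp d → ℝ) → ℝ}
    {u v u' v' : Sp d → ℝ} {ea : Fin d → Fin d → ℝ} {eb : Fin d → ℝ} {ec e1 ef eg : ℝ}
    (ha : ∀ i j, |I (p.a i j) (fun x => pd i u x * pd j v x) -
      I' (p.a i j) (fun x => pd i u' x * pd j v' x)| ≤ ea i j)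
    (hb : ∀ i, |I (p.b i) (fun x => pd i u x * v x) - I' (p.b i) (fun x => pd i u' x * v' x)| ≤ eb i)
    (hc : |I p.c (fun x => u x * v x) - I' p.c (fun x => u' x * v' x)| ≤ ec)
    (h1 : |J (fun _ => 1) (fun x => u x * v x) - J' (fun _ => 1) (fun x => u' x * v' x)| ≤ e1)
    (hf : |I p.f v - I' p.f v'| ≤ ef) (hg : |J p.g v - J' p.g v'| ≤ eg) :
    |robinForm p α β I J u v - robinForm p α β I' J' u' v'| ≤
      (∑ i, ∑ j, ea i j) + (∑ i, eb i) + ec + |α / β| * e1 + ef + |1 / β| * eg := by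
  have Ha : |(∑ i, ∑ j, I (p.a i j) fun x => pd i u x * pd j v x) -
      ∑ i, ∑ j, I' (p.a i j) fun x => pd i u' x * pd j v' x| ≤ ∑ i, ∑ j, ea i j := by
    simp only [← Finset.sum_sub_distrib]
    refine (Finset.abs_sum_le_sum_abs _ _).trans (Finset.sum_le_sum fun i _ => ?_)
    exact (Finset.abs_sum_le_sum_abs _ _).trans (Finset.sum_le_sum fun j _ => ha i j)
  have Hb : |(∑ i, I (p.b i) fun x => pd i u x * v x) -
      ∑ i, I' (p.b i) fun x => pd i u' x * v' x| ≤ ∑ i, eb i := by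
    simp only [← Finset.sum_sub_distrib]
    exact (Finset.abs_sum_le_sum_abs _ _).trans (Finset.sum_le_sum fun i _ => hb i)
  have H1 := mul_le_mul_of_nonneg_left h1 (abs_nonneg (α / β))
  have Hg := mul_le_mul_of_nonneg_left hg (abs_nonneg (1 / β))
  rw [← abs_mul, mul_sub] at H1 Hg
  unfold robinForm
  rw [abs_le] at *
  constructor <;> linarith

/-- At the point `x`, all products of `u`, `v` and their derivatives that occur in the Galerkin
functional differ by at most `η` from those of `u'`, `v'`. -/
def TermsClose (η : ℝ) (u v u' v' : Sp d → ℝ) (x : Sp d) : Prop :=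
  (∀ i j, |pd i u x * pd j v x - pd i u' x * pd j v' x| ≤ η) ∧
    (∀ i, |pd i u x * v x - pd i u' x * v' x| ≤ η) ∧
    |u x * v x - u' x * v' x| ≤ η ∧ |v x - v' x| ≤ η

/-- The jet of `u` at `x` is bounded by `R`. -/
def JetBounded (R : ℝ) (u : Sp d → ℝ) (x : Sp d) : Prop :=
  |u x| ≤ R ∧ ∀ i, |pd i u x| ≤ R

theorem abs_mul_sub_mul_le {a b a' b' A B ε : ℝ} (ha : |a| ≤ A) (hb' : |b'| ≤ B)
    (haa : |a - a'| ≤ ε) (hbb : |b - b'| ≤ ε) : |a * b - a' * b'| ≤ (A + B) * ε := by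
  have e : a * b - a' * b' = a * (b - b') + (a - a') * b' := by ring
  have hε : 0 ≤ ε := (abs_nonneg _).trans haa
  rw [e]
  refine (abs_add_le _ _).trans ?_
  rw [abs_mul, abs_mul]
  calc _ ≤ A * ε + ε * B := add_le_add
        (mul_le_mul ha hbb (abs_nonneg _) ((abs_nonneg _).trans ha))
        (mul_le_mul haa hb' (abs_nonneg _) hε)
    _ = (A + B) * ε := by ring

theorem TermsClose.of_close {R ε : ℝ} (hR : 1 ≤ R) {u v u' v' : Sp d → ℝ} {x : Sp d}
    (hu : JetBounded R u x) (hv' : JetBounded R v' x)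
    (huu : |u x - u' x| ≤ ε ∧ ∀ i, |pd i u x - pd i u' x| ≤ ε)
    (hvv : |v x - v' x| ≤ ε ∧ ∀ i, |pd i v x - pd i v' x| ≤ ε) :
    TermsClose ((R + R) * ε) u v u' v' x := by
  have hε : 0 ≤ ε := (abs_nonneg _).trans huu.1
  refine ⟨fun i j => abs_mul_sub_mul_le (hu.2 i) (hv'.2 j) (huu.2 i) (hvv.2 j),
    fun i => abs_mul_sub_mul_le (hu.2 i) hv'.1 (huu.2 i) hvv.1,
    abs_mul_sub_mul_le hu.1 hv'.1 huu.1 hvv.1, hvv.1.trans ?_⟩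
  nlinarith

theorem TermsClose.zero {R : ℝ} (hR : 1 ≤ R) {u v : Sp d → ℝ} {x : Sp d}
    (hu : JetBounded R u x) (hv : JetBounded R v x) :
    TermsClose (R * R) u v (fun _ => 0) (fun _ => 0) x := by
  have hR0 : 0 ≤ R := by linarith
  have key : ∀ a b : ℝ, |a| ≤ R → |b| ≤ R → |a * b| ≤ R * R := fun a b ha hb => by
    rw [abs_mul]; exact mul_le_mul ha hb (abs_nonneg _) hR0
  refine ⟨fun i j => ?_, fun i => ?_, ?_, ?_⟩
  · simpa [pd_const] using key _ _ (hu.2 i) (hv.2 j)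
  · simpa [pd_const] using key _ _ (hu.2 i) hv.1
  · simpa using key _ _ hu.1 hv.1
  · simpa using hv.1.trans (by nlinarith)

theorem robinForm_zero (p : Coeffs d) (α β : ℝ) {I J : (Sp d → ℝ) → (Sp d → ℝ) → ℝ}
    (hI : ∀ w, I w (fun _ => 0) = 0) (hJ : ∀ w, J w (fun _ => 0) = 0) :
    robinForm p α β I J (fun _ => 0) (fun _ => 0) = 0 := by
  simp [robinForm, pd_const, hI, hJ]

theorem unitCube_eq (d : ℕ) : unitCube d = (WithLp.ofLp : Sp d → Fin d → ℝ) ⁻¹' Set.Icc 0 1 := by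
  ext x
  simp [unitCube, Pi.le_def, forall_and]

theorem isCompact_unitCube (d : ℕ) : IsCompact (unitCube d) := by
  rw [unitCube_eq]
  exact (EuclideanSpace.equiv (Fin d) ℝ).toHomeomorph.isCompact_preimage.2 isCompact_Icc

theorem volume_unitCube (d : ℕ) : volume (unitCube d) = 1 := by
  rw [unitCube_eq, (PiLp.volume_preserving_ofLp (Fin d)).measure_preimage
    measurableSet_Icc.nullMeasurableSet, Real.volume_Icc_pi]
  simp

theorem frontier_subset_unitCube {Ω : Set (Sp d)} (hΩ : Ω ⊆ unitCube d) :
    frontier Ω ⊆ unitCube d :=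
  frontier_subset_closure.trans ((isCompact_unitCube d).isClosed.closure_subset_iff.2 hΩ)

/-- A continuous function may be multiplied to an integrable weight over a part of the cube. -/
theorem integrableOn_mul_of_continuous {ν : Measure (Sp d)} {A : Set (Sp d)} (hAm : MeasurableSet A)
    (hA : A ⊆ unitCube d) {w h : Sp d → ℝ} (hw : Integrable w (ν.restrict A)) (hh : Continuous h) :
    Integrable (fun x => w x * h x) (ν.restrict A) := by
  obtain ⟨C, hC⟩ := (isCompact_unitCube d).exists_bound_of_continuousOn hh.continuousOn
  refine hw.mul_bdd (c := C) hh.aestronglyMeasurable ?_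
  exact (ae_restrict_iff' hAm).2 (ae_of_all _ fun x hx => hC x (hA hx))

theorem abs_setIntegral_mul_sub_le {ν : Measure (Sp d)} {A : Set (Sp d)} (hAm : MeasurableSet A)
    (hA : A ⊆ unitCube d) {w h h' : Sp d → ℝ} (hw : Integrable w (ν.restrict A))
    (hh : Continuous h) (hh' : Continuous h') {η : ℝ} (hη : ∀ x ∈ unitCube d, |h x - h' x| ≤ η) :
    |(∫ x in A, w x * h x ∂ν) - ∫ x in A, w x * h' x ∂ν| ≤ η * ∫ x in A, |w x| ∂ν := by
  have i1 := integrableOn_mul_of_continuous hAm hA hw hh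
  have i2 := integrableOn_mul_of_continuous hAm hA hw hh'
  rw [← integral_sub i1 i2, ← integral_const_mul]
  refine abs_integral_le_integral_abs.trans ?_
  refine integral_mono_ae (i1.sub i2).abs (hw.abs.const_mul _) ?_
  refine (ae_restrict_iff' hAm).2 (ae_of_all _ fun x hx => ?_)
  simp only [← mul_sub, abs_mul]
  rw [mul_comm]
  exact mul_le_mul_of_nonneg_right (hη x (hA hx)) (abs_nonneg _)

theorem abs_mean_mul_sub_le {N : ℕ} {c : ℝ} (hc : 0 ≤ c) (X : Fin N → Sp d) {w h h' : Sp d → ℝ}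
    {η : ℝ} (hη : ∀ k, |h (X k) - h' (X k)| ≤ η) :
    |c / N * (∑ k, w (X k) * h (X k)) - c / N * ∑ k, w (X k) * h' (X k)| ≤
      η * (c / N * ∑ k, |w (X k)|) := by
  rw [← mul_sub, ← Finset.sum_sub_distrib, abs_mul, abs_of_nonneg (by positivity : 0 ≤ c / (N : ℝ)),
    mul_left_comm]
  refine mul_le_mul_of_nonneg_left ?_ (by positivity)
  rw [Finset.mul_sum]
  refine (Finset.abs_sum_le_sum_abs _ _).trans (Finset.sum_le_sum fun k _ => ?_)
  rw [← mul_sub, abs_mul, mul_comm]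
  exact mul_le_mul_of_nonneg_right (hη k) (abs_nonneg _)

end Galerkin

/-! ### Square integrable weights and uniform samples -/

section Weights

variable {d : ℕ}

/-- `w` is square integrable over `A`, with `L²` norm at most `W`. -/
def IsWeight (ν : Measure (Sp d)) (A : Set (Sp d)) (W : ℝ) (w : Sp d → ℝ) : Prop :=
  MemLp w 2 (ν.restrict A) ∧ ∫ x in A, w x ^ 2 ∂ν ≤ W ^ 2

theorem IsWeight.integrable {ν : Measure (Sp d)} {A : Set (Sp d)} {W : ℝ} {w : Sp d → ℝ}
    (hw : IsWeight ν A W w) (hA : ν A ≠ ⊤) : Integrable w (ν.restrict A) := by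
  have : IsFiniteMeasure (ν.restrict A) := ⟨by simpa using hA.lt_top⟩
  exact hw.1.integrable (by norm_num)

theorem IsWeight.aemeasurable_cond {ν : Measure (Sp d)} {A : Set (Sp d)} {W : ℝ} {w : Sp d → ℝ}
    (hw : IsWeight ν A W w) : AEMeasurable w (cond ν A) :=
  hw.1.aestronglyMeasurable.aemeasurable.smul_measure _

theorem IsWeight.of_eLpNorm {ν : Measure (Sp d)} {A : Set (Sp d)} {W : ℝ} (hW : 0 ≤ W)
    {w : Sp d → ℝ} (hw : MemLp w 2 (ν.restrict A))
    (hle : eLpNorm w 2 (ν.restrict A) ≤ ENNReal.ofReal W) : IsWeight ν A W w := by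
  refine ⟨hw, ?_⟩
  rw [hw.eLpNorm_eq_integral_rpow_norm (by norm_num) (by norm_num),
    ENNReal.ofReal_le_ofReal_iff hW] at hle
  simp only [ENNReal.toReal_ofNat, Real.rpow_two, Real.norm_eq_abs, sq_abs] at hle
  have h0 : 0 ≤ ∫ x in A, w x ^ 2 ∂ν := integral_nonneg fun x => sq_nonneg _
  have h1 := pow_le_pow_left₀ (Real.rpow_nonneg h0 _) hle 2
  rwa [← Real.rpow_natCast, ← Real.rpow_mul h0, Nat.cast_ofNat, inv_mul_cancel₀ (by norm_num),
    Real.rpow_one] at h1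

theorem IsWeight.of_bound {ν : Measure (Sp d)} {A : Set (Sp d)} {W V : ℝ}
    (hA : ν A ≠ ⊤) (hV : ν.real A ≤ V ^ 2) {w : Sp d → ℝ}
    (hw : AEStronglyMeasurable w (ν.restrict A)) (hle : ∀ᵐ x ∂(ν.restrict A), |w x| ≤ W) :
    IsWeight ν A (V * W) w := by
  have : IsFiniteMeasure (ν.restrict A) := ⟨by simpa using hA.lt_top⟩
  refine ⟨MemLp.of_bound hw W hle, ?_⟩
  calc ∫ x in A, w x ^ 2 ∂ν ≤ ∫ _x in A, W ^ 2 ∂ν := by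
        refine integral_mono_ae (MemLp.of_bound hw W hle).integrable_sq (integrable_const _) ?_
        filter_upwards [hle] with x hx
        rw [← sq_abs]
        exact pow_le_pow_left₀ (abs_nonneg _) hx 2
    _ = ν.real A * W ^ 2 := by simp
    _ ≤ V ^ 2 * W ^ 2 := by gcongr
    _ = (V * W) ^ 2 := by ring

/-- The deviation bound for samples from the uniform distribution on `A`, in terms of integrals
over `A`. -/
theorem exists_deviation_bound_cond {ν : Measure (Sp d)} {A : Set (Sp d)} (hAm : MeasurableSet A)
    (h0 : ν A ≠ 0) (htop : ν A ≠ ⊤) {V W : ℝ} (hV : 0 ≤ V) (hVA : ν.real A ≤ V ^ 2) (hW : 0 < W)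
    {w : Sp d → ℝ} (hw : IsWeight ν A W w) {T : Type*} [Nonempty T] {h : T → Sp d → ℝ} {M ε : ℝ}
    (hM : 0 < M) (hε : 0 ≤ ε) (hcont : ∀ t, Continuous (h t)) (hhM : ∀ t, ∀ x ∈ A, |h t x| ≤ M)
    {m : ℕ} (κ : T → Fin m) (hκ : ∀ s t, κ s = κ t → ∀ x ∈ A, |h s x - h t x| ≤ ε)
    {N : ℕ} (hN : 1 ≤ N) :
    ∃ Ψ : (Fin N → Sp d) → ℝ, Integrable Ψ (Measure.pi fun _ => cond ν A) ∧
      (∀ᵐ X ∂(Measure.pi fun _ : Fin N => cond ν A), ∀ t,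
        |(∫ x in A, w x * h t x ∂ν) - ν.real A / N * ∑ k, w (X k) * h t (X k)| ≤ Ψ X) ∧
      ∫ X, Ψ X ∂(Measure.pi fun _ => cond ν A) ≤
        V * W * (2 * ε + 6 * M * √(Real.log (2 * m) / N)) := by
  have := cond_isProbabilityMeasure_of_finite h0 htop
  set a := ν.real A with ha
  have ha0 : 0 < a := ENNReal.toReal_pos h0 htop
  have hcond : ∀ f : Sp d → ℝ, ∫ x, f x ∂(cond ν A) = 1 / a * ∫ x in A, f x ∂ν := by
    intro f
    rw [ProbabilityTheory.cond, integral_smul_measure, ENNReal.toReal_inv, smul_eq_mul, one_div]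
    rfl
  have hs0 : 0 < √a := Real.sqrt_pos.2 ha0
  have hs2 : √a ^ 2 = a := Real.sq_sqrt ha0.le
  have hsV : √a ≤ V := (Real.sqrt_le_sqrt hVA).trans_eq (Real.sqrt_sq hV)
  have hmem : ∀ᵐ x ∂(cond ν A), x ∈ A := Measure.ae_smul_measure (ae_restrict_mem hAm) _
  have hw2 : MemLp w 2 (cond ν A) := hw.1.smul_measure (by simpa using h0)
  obtain ⟨Ψ, h1, h2, h3⟩ := exists_deviation_bound hmem (W := W / √a) (by positivity)
    hw2 (by rw [hcond, div_pow, hs2, one_div, div_eq_inv_mul]; gcongr; exact hw.2)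
    hM hε (fun t => (hcont t).aestronglyMeasurable) hhM κ hκ hN
  refine ⟨fun X => a * Ψ X, h1.const_mul _, ?_, ?_⟩
  · filter_upwards [h2] with X hX t
    have h4 : (∫ x in A, w x * h t x ∂ν) - a / N * ∑ k, w (X k) * h t (X k) =
        -(a * (1 / (N : ℝ) * ∑ k, w (X k) * h t (X k) - ∫ x, w x * h t x ∂(cond ν A))) := by
      rw [hcond]; field_simp; ring
    rw [h4, abs_neg, abs_mul, abs_of_pos ha0]
    exact mul_le_mul_of_nonneg_left (hX t) ha0.le
  · rw [integral_const_mul]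
    calc _ ≤ a * (W / √a * (2 * ε + 6 * M * √(Real.log (2 * m) / N))) := by gcongr
      _ = √a * W * (2 * ε + 6 * M * √(Real.log (2 * m) / N)) := by
          have : a = √a * √a := (Real.mul_self_sqrt ha0.le).symm
          rw [← mul_assoc, mul_div_assoc']
          congr 1
          rw [div_eq_iff hs0.ne']
          nth_rewrite 1 [this]
          ring
      _ ≤ V * W * (2 * ε + 6 * M * √(Real.log (2 * m) / N)) := by gcongr


variable {d : ℕ}

/-- The assumptions on the coefficients and data that enter the estimates: all of them are square
integrable, with norms at most `W`. -/
structure HasWeights (p : Coeffs d) (Ω : Set (Sp d)) (W : ℝ) : Prop where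
  a : ∀ i j, IsWeight volume Ω W (p.a i j)
  b : ∀ i, IsWeight volume Ω W (p.b i)
  c : IsWeight volume Ω W p.c
  f : IsWeight volume Ω W p.f
  one : IsWeight (surf d) (frontier Ω) W fun _ => 1
  g : IsWeight (surf d) (frontier Ω) W p.g

theorem volume_real_le_one {Ω : Set (Sp d)} (hΩ : Ω ⊆ unitCube d) : volume.real Ω ≤ 1 := by
  have := measure_mono (μ := volume) hΩ
  rw [volume_unitCube] at this
  exact ENNReal.toReal_le_of_le_ofReal zero_le_one (by simpa using this)

theorem volume_ne_top {Ω : Set (Sp d)} (hΩ : Ω ⊆ unitCube d) : volume Ω ≠ ⊤ := by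
  have := measure_mono (μ := volume) hΩ
  rw [volume_unitCube] at this
  exact (this.trans_lt ENNReal.one_lt_top).ne

theorem Coeffs.Admissible.hasWeights {p : Coeffs d} {Ω : Set (Sp d)} {K V W : ℝ}
    (hp : p.Admissible Ω K) (hΩo : IsOpen Ω) (hΩ : Ω ⊆ unitCube d) (hKW : K ≤ W) (hVW : V ≤ W)
    (hW : 0 ≤ W) (hV : 0 ≤ V) (htop : surf d (frontier Ω) ≠ ⊤)
    (hS : (surf d).real (frontier Ω) ≤ V ^ 2) : HasWeights p Ω W := by
  have hv : volume.real Ω ≤ 1 ^ 2 := by simpa using volume_real_le_one hΩ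
  have hinf : ∀ w : Sp d → ℝ, MemLp w ⊤ (volume.restrict Ω) →
      eLpNorm w ⊤ (volume.restrict Ω) ≤ ENNReal.ofReal K → IsWeight volume Ω W w := by
    intro w hw hle
    have h1 := IsWeight.of_bound (W := W) (volume_ne_top hΩ) hv hw.aestronglyMeasurable ?_
    · rwa [one_mul] at h1
    · filter_upwards [ae_le_eLpNormEssSup (f := w) (μ := volume.restrict Ω)] with x hx
      rw [eLpNorm_exponent_top] at hle
      have h2 := (hx.trans hle).trans (ENNReal.ofReal_le_ofReal hKW)
      rw [← ofReal_norm, ENNReal.ofReal_le_ofReal_iff hW] at h2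
      exact h2
  have hle := ENNReal.ofReal_le_ofReal hKW
  refine ⟨fun i j => ?_, fun i => hinf _ (hp.b_mem i) (hp.b_le i), hinf _ hp.c_mem hp.c_le,
    IsWeight.of_eLpNorm hW hp.f_mem (hp.f_le.trans hle), ?_,
    IsWeight.of_eLpNorm hW hp.g_mem (hp.g_le.trans hle)⟩
  · have h1 := IsWeight.of_bound (W := W) (volume_ne_top hΩ) hv
      (((hp.a_cont i j).mono subset_closure).aestronglyMeasurable hΩo.measurableSet) ?_
    · rwa [one_mul] at h1
    · exact (ae_restrict_iff' hΩo.measurableSet).2 (ae_of_all _ fun x hx =>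
        (hp.a_le i j x (subset_closure hx)).trans hKW)
  · have h1 := IsWeight.of_bound (W := 1) (w := fun _ => (1 : ℝ)) htop hS
      aestronglyMeasurable_const (by simp)
    rw [mul_one] at h1
    exact ⟨h1.1, h1.2.trans (pow_le_pow_left₀ hV hVW 2)⟩

end Weights

/-! ### Boundedness and measurability of the statistical error -/

section Suprema

/-- Suprema of uniformly close functions are close. -/
theorem abs_ciSup_sub_ciSup_le {ι : Type*} [Nonempty ι] {F F' : ι → ℝ} {C : ℝ}
    (hF : BddAbove (Set.range F)) (hF' : BddAbove (Set.range F')) (h : ∀ i, |F i - F' i| ≤ C) :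
    |(⨆ i, F i) - ⨆ i, F' i| ≤ C := by
  rw [abs_le]
  constructor
  · have : (⨆ i, F' i) ≤ (⨆ i, F i) + C := ciSup_le fun i => by
      linarith [le_ciSup hF i, (abs_le.1 (h i)).1]
    linarith
  · have : (⨆ i, F i) ≤ (⨆ i, F' i) + C := ciSup_le fun i => by
      linarith [le_ciSup hF' i, (abs_le.1 (h i)).2]
    linarith

/-- The supremum of a bounded function is its supremum over a family along which all its values are
approximated. -/
theorem ciSup_eq_ciSup_of_approx {ι κ : Type*} [Nonempty ι] {F : ι → ℝ}
    (hF : BddAbove (Set.range F)) (r : κ → ι)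
    (h : ∀ i, ∀ η > 0, ∃ k, |F i - F (r k)| ≤ η) : (⨆ i, F i) = ⨆ k, F (r k) := by
  have : Nonempty κ := ⟨(h (Classical.arbitrary ι) 1 one_pos).choose⟩
  have hb : BddAbove (Set.range fun k => F (r k)) :=
    hF.mono (Set.range_comp_subset_range r F)
  refine le_antisymm (ciSup_le fun i => le_of_forall_pos_le_add fun η hη => ?_)
    (ciSup_le fun k => le_ciSup hF (r k))
  obtain ⟨k, hk⟩ := h i η hη
  linarith [le_ciSup hb k, (abs_le.1 hk).2]

end Suprema

section Classes

variable {d : ℕ}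

/-- A class of `C¹` functions with gradients bounded by `G` and of at most linear growth, which is
totally bounded in `C¹` of the unit cube. -/
structure JetClass (P : Set (Sp d → ℝ)) (G : ℝ) : Prop where
  one_le : 1 ≤ G
  grad : ∀ u ∈ P, GradBounded G u
  abs_le : ∀ u ∈ P, ∀ x, |u x| ≤ 2 * G * (1 + ∑ i, |x i|)
  cells : ∀ ε > 0, ∃ m, HasCells P ε m

theorem JetClass.jetBounded {P : Set (Sp d → ℝ)} {G : ℝ} (hP : JetClass P G) {u : Sp d → ℝ}
    (hu : u ∈ P) (x : Sp d) : JetBounded (2 * G * (1 + ∑ i, |x i|)) u x := by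
  refine ⟨hP.abs_le u hu x, fun i => ((hP.grad u hu).2 i x).trans ?_⟩
  have h1 : 0 ≤ ∑ i, |x i| := Finset.sum_nonneg fun i _ => abs_nonneg _
  nlinarith [hP.one_le]

theorem JetClass.jetBounded_unitCube {P : Set (Sp d → ℝ)} {G : ℝ} (hP : JetClass P G)
    (hd : 1 ≤ d) {u : Sp d → ℝ} (hu : u ∈ P) {x : Sp d} (hx : x ∈ unitCube d) :
    JetBounded (4 * d * G) u x := by
  have hG := hP.one_le
  have hd' : (1 : ℝ) ≤ d := by exact_mod_cast hd
  have h1 : ∑ i, |x i| ≤ d := by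
    calc ∑ i, |x i| ≤ ∑ _i : Fin d, (1 : ℝ) := Finset.sum_le_sum fun i _ => by
          rw [abs_of_nonneg (hx i).1]; exact (hx i).2
      _ = d := by simp
  have h2 : 2 * G * (1 + ∑ i, |x i|) ≤ 4 * d * G := by nlinarith
  exact ⟨((hP.jetBounded hu x).1).trans h2, fun i => ((hP.jetBounded hu x).2 i).trans h2⟩

theorem JetClass.continuous {P : Set (Sp d → ℝ)} {G : ℝ} (hP : JetClass P G) {u : Sp d → ℝ}
    (hu : u ∈ P) : Continuous u := (hP.grad u hu).1.continuous

theorem JetClass.continuous_pd {P : Set (Sp d → ℝ)} {G : ℝ} (hP : JetClass P G) {u : Sp d → ℝ}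
    (hu : u ∈ P) (i : Fin d) : Continuous (pd i u) := DGMW.continuous_pd i (hP.grad u hu).1

/-- A totally bounded class contains a countable `C¹`-dense family. -/
theorem JetClass.exists_countable_dense {P : Set (Sp d → ℝ)} {G : ℝ} (hP : JetClass P G)
    (hne : P.Nonempty) : ∃ r : ℕ × ℕ → P, ∀ u : P, ∀ ε > 0, ∃ k, JetClose ε (u : Sp d → ℝ) (r k : Sp d → ℝ) := by
  classical
  have hpos : ∀ j : ℕ, (0 : ℝ) < 1 / ((j : ℝ) + 1) := fun j => by positivity
  choose m κ hκ using fun j : ℕ => hP.cells _ (hpos j)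
  have : Nonempty P := hne.to_subtype
  refine ⟨fun k => if h : ∃ u : P, (κ k.1 u : ℕ) = k.2 then h.choose else Classical.arbitrary P, ?_⟩
  intro u ε hε
  obtain ⟨j, hj⟩ := exists_nat_one_div_lt hε
  refine ⟨(j, κ j u), ?_⟩
  have h : ∃ v : P, (κ j v : ℕ) = κ j u := ⟨u, rfl⟩
  simp only [dif_pos h]
  exact (hκ j _ u.2 _ h.choose.2 (Fin.ext h.choose_spec.symm)).mono hj.le

end Classes

section Bounds

variable {d : ℕ} {p : Coeffs d} {Ω : Set (Sp d)} {W G : ℝ} {P : Set (Sp d → ℝ)}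

/-- The Galerkin functional is Lipschitz with respect to the products that occur in it. -/
theorem exists_abs_galerkin_sub_le (hw : HasWeights p Ω W) (hΩo : IsOpen Ω) (hΩ : Ω ⊆ unitCube d)
    (htop : surf d (frontier Ω) ≠ ⊤) (α β : ℝ) : ∃ C, 0 ≤ C ∧ ∀ u v u' v' : Sp d → ℝ,
      ContDiff ℝ 1 u → ContDiff ℝ 1 v → ContDiff ℝ 1 u' → ContDiff ℝ 1 v' →
      ∀ η, (∀ x ∈ unitCube d, TermsClose η u v u' v' x) →
        |galerkin p Ω α β u v - galerkin p Ω α β u' v'| ≤ η * C := by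
  refine ⟨(∑ i, ∑ j, ∫ x in Ω, |p.a i j x|) + (∑ i, ∫ x in Ω, |p.b i x|) + (∫ x in Ω, |p.c x|) +
    |α / β| * (∫ _y in frontier Ω, |(1 : ℝ)| ∂(surf d)) + (∫ x in Ω, |p.f x|) +
    |1 / β| * (∫ y in frontier Ω, |p.g y| ∂(surf d)), by positivity, ?_⟩
  intro u v u' v' hu hv hu' hv' η hη
  have hv1 := volume_ne_top hΩ
  have hfm : MeasurableSet (frontier Ω) := isClosed_frontier.measurableSet
  have hfr := frontier_subset_unitCube hΩ
  rw [galerkin_eq_robinForm, galerkin_eq_robinForm]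
  refine (abs_robinForm_sub_le p α β
    (fun i j => abs_setIntegral_mul_sub_le hΩo.measurableSet hΩ ((hw.a i j).integrable hv1)
      ((continuous_pd i hu).mul (continuous_pd j hv))
      ((continuous_pd i hu').mul (continuous_pd j hv')) fun x hx => (hη x hx).1 i j)
    (fun i => abs_setIntegral_mul_sub_le hΩo.measurableSet hΩ ((hw.b i).integrable hv1)
      ((continuous_pd i hu).mul hv.continuous) ((continuous_pd i hu').mul hv'.continuous)
      fun x hx => (hη x hx).2.1 i)
    (abs_setIntegral_mul_sub_le hΩo.measurableSet hΩ (hw.c.integrable hv1)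
      (hu.continuous.mul hv.continuous) (hu'.continuous.mul hv'.continuous)
      fun x hx => (hη x hx).2.2.1)
    (abs_setIntegral_mul_sub_le hfm hfr (hw.one.integrable htop)
      (hu.continuous.mul hv.continuous) (hu'.continuous.mul hv'.continuous)
      fun x hx => (hη x hx).2.2.1)
    (abs_setIntegral_mul_sub_le hΩo.measurableSet hΩ (hw.f.integrable hv1)
      hv.continuous hv'.continuous fun x hx => (hη x hx).2.2.2)
    (abs_setIntegral_mul_sub_le hfm hfr (hw.g.integrable htop)
      hv.continuous hv'.continuous fun x hx => (hη x hx).2.2.2)).trans (le_of_eq ?_)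
  simp only [← Finset.mul_sum]
  ring

/-- For fixed samples, the empirical functional is Lipschitz with respect to the products that
occur in it, evaluated at the samples. -/
theorem exists_abs_galerkinEmp_sub_le (p : Coeffs d) (Ω : Set (Sp d)) (α β : ℝ) {N M : ℕ}
    (X : Fin N → Sp d) (Y : Fin M → Sp d) : ∃ C, 0 ≤ C ∧ ∀ u v u' v' : Sp d → ℝ,
      ∀ η, (∀ k, TermsClose η u v u' v' (X k)) → (∀ k, TermsClose η u v u' v' (Y k)) →
        |galerkinEmp p Ω α β X Y u v - galerkinEmp p Ω α β X Y u' v'| ≤ η * C := by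
  obtain ⟨c, hc⟩ : ∃ c, c = volume.real Ω := ⟨_, rfl⟩
  obtain ⟨s, hs⟩ : ∃ s, s = (surf d).real (frontier Ω) := ⟨_, rfl⟩
  have hc0 : 0 ≤ c := hc ▸ measureReal_nonneg
  have hs0 : 0 ≤ s := hs ▸ measureReal_nonneg
  have hpos : ∀ w : Sp d → ℝ, 0 ≤ c / N * ∑ k, |w (X k)| := fun w =>
    mul_nonneg (by positivity) (Finset.sum_nonneg fun _ _ => abs_nonneg _)
  have hpos' : ∀ w : Sp d → ℝ, 0 ≤ s / M * ∑ k, |w (Y k)| := fun w =>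
    mul_nonneg (by positivity) (Finset.sum_nonneg fun _ _ => abs_nonneg _)
  refine ⟨(∑ i, ∑ j, c / N * ∑ k, |p.a i j (X k)|) + (∑ i, c / N * ∑ k, |p.b i (X k)|) +
    (c / N * ∑ k, |p.c (X k)|) + |α / β| * (s / M * ∑ _k : Fin M, |(1 : ℝ)|) +
    (c / N * ∑ k, |p.f (X k)|) + |1 / β| * (s / M * ∑ k, |p.g (Y k)|), ?_, ?_⟩
  · have h1 := Finset.sum_nonneg fun i (_ : i ∈ Finset.univ) =>
      Finset.sum_nonneg fun j (_ : j ∈ Finset.univ) => hpos (p.a i j)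
    have h2 := Finset.sum_nonneg fun i (_ : i ∈ Finset.univ) => hpos (p.b i)
    have h3 := mul_nonneg (abs_nonneg (α / β)) (hpos' fun _ => 1)
    have h4 := mul_nonneg (abs_nonneg (1 / β)) (hpos' p.g)
    linarith [hpos p.c, hpos p.f]
  intro u v u' v' η hX hY
  rw [galerkinEmp_eq_robinForm, galerkinEmp_eq_robinForm, ← hc, ← hs]
  have key := abs_robinForm_sub_le p α β (u := u) (v := v) (u' := u') (v' := v')
    (I := fun w h => c / N * ∑ k, w (X k) * h (X k)) (I' := fun w h => c / N * ∑ k, w (X k) * h (X k))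
    (J := fun w h => s / M * ∑ k, w (Y k) * h (Y k)) (J' := fun w h => s / M * ∑ k, w (Y k) * h (Y k))
    (ea := fun i j => η * (c / N * ∑ k, |p.a i j (X k)|))
    (eb := fun i => η * (c / N * ∑ k, |p.b i (X k)|)) (ec := η * (c / N * ∑ k, |p.c (X k)|))
    (e1 := η * (s / M * ∑ _k : Fin M, |(1 : ℝ)|)) (ef := η * (c / N * ∑ k, |p.f (X k)|))
    (eg := η * (s / M * ∑ k, |p.g (Y k)|))
    (fun i j => abs_mean_mul_sub_le (w := p.a i j) (h := fun x => pd i u x * pd j v x)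
      (h' := fun x => pd i u' x * pd j v' x) hc0 X fun k => (hX k).1 i j)
    (fun i => abs_mean_mul_sub_le (w := p.b i) (h := fun x => pd i u x * v x)
      (h' := fun x => pd i u' x * v' x) hc0 X fun k => (hX k).2.1 i)
    (abs_mean_mul_sub_le (w := p.c) (h := fun x => u x * v x) (h' := fun x => u' x * v' x)
      hc0 X fun k => (hX k).2.2.1)
    (abs_mean_mul_sub_le (w := fun _ => 1) (h := fun x => u x * v x) (h' := fun x => u' x * v' x)
      hs0 Y fun k => (hY k).2.2.1)
    (abs_mean_mul_sub_le (w := p.f) (h := v) (h' := v') hc0 X fun k => (hX k).2.2.2)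
    (abs_mean_mul_sub_le (w := p.g) (h := v) (h' := v') hs0 Y fun k => (hY k).2.2.2)
  refine key.trans (le_of_eq ?_)
  have e1 : (∑ i, ∑ j, η * (c / N * ∑ k, |p.a i j (X k)|)) =
      η * ∑ i, ∑ j, c / N * ∑ k, |p.a i j (X k)| := by simp only [Finset.mul_sum]
  have e2 : (∑ i, η * (c / N * ∑ k, |p.b i (X k)|)) = η * ∑ i, c / N * ∑ k, |p.b i (X k)| := by
    simp only [Finset.mul_sum]
  rw [e1, e2]
  ring

theorem galerkin_zero (p : Coeffs d) (Ω : Set (Sp d)) (α β : ℝ) :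
    galerkin p Ω α β (fun _ => 0) (fun _ => 0) = 0 := by
  rw [galerkin_eq_robinForm]
  exact robinForm_zero p α β (by simp) (by simp)

theorem galerkinEmp_zero (p : Coeffs d) (Ω : Set (Sp d)) (α β : ℝ) {N M : ℕ}
    (X : Fin N → Sp d) (Y : Fin M → Sp d) :
    galerkinEmp p Ω α β X Y (fun _ => 0) (fun _ => 0) = 0 := by
  rw [galerkinEmp_eq_robinForm]
  exact robinForm_zero p α β (by simp) (by simp)

theorem exists_abs_galerkin_le (hd : 1 ≤ d) (hw : HasWeights p Ω W) (hΩo : IsOpen Ω)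
    (hΩ : Ω ⊆ unitCube d) (htop : surf d (frontier Ω) ≠ ⊤) (hP : JetClass P G) (α β : ℝ) :
    ∃ C, ∀ u ∈ P, ∀ v ∈ P, |galerkin p Ω α β u v| ≤ C := by
  obtain ⟨C, -, hC⟩ := exists_abs_galerkin_sub_le hw hΩo hΩ htop α β
  have hd' : (1 : ℝ) ≤ d := by exact_mod_cast hd
  have hR : 1 ≤ 4 * d * G := by nlinarith [hP.one_le]
  refine ⟨(4 * d * G) * (4 * d * G) * C, fun u hu v hv => ?_⟩
  have := hC u v (fun _ => 0) (fun _ => 0) (hP.grad u hu).1 (hP.grad v hv).1 contDiff_const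
    contDiff_const _ fun x hx => TermsClose.zero hR (hP.jetBounded_unitCube hd hu hx)
      (hP.jetBounded_unitCube hd hv hx)
  rwa [galerkin_zero, sub_zero] at this

theorem exists_abs_galerkinEmp_le (hP : JetClass P G) (p : Coeffs d) (Ω : Set (Sp d)) (α β : ℝ)
    {N M : ℕ} (X : Fin N → Sp d) (Y : Fin M → Sp d) :
    ∃ C, ∀ u ∈ P, ∀ v ∈ P, |galerkinEmp p Ω α β X Y u v| ≤ C := by
  obtain ⟨C, -, hC⟩ := exists_abs_galerkinEmp_sub_le p Ω α β X Y
  let q : Sp d → ℝ := fun x => 2 * G * (1 + ∑ i, |x i|)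
  have hG := hP.one_le
  have hq : ∀ x, 0 ≤ q x := fun x => by
    have h1 : 0 ≤ ∑ i, |x i| := Finset.sum_nonneg fun i _ => abs_nonneg _
    positivity
  set R := 1 + (∑ k, q (X k)) + ∑ k, q (Y k) with hRdef
  have hX0 : 0 ≤ ∑ k, q (X k) := Finset.sum_nonneg fun k _ => hq _
  have hY0 : 0 ≤ ∑ k, q (Y k) := Finset.sum_nonneg fun k _ => hq _
  have hX : ∀ k, q (X k) ≤ R := fun k => by
    have := Finset.single_le_sum (f := fun k => q (X k)) (fun k _ => hq _) (Finset.mem_univ k)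
    linarith
  have hY : ∀ k, q (Y k) ≤ R := fun k => by
    have := Finset.single_le_sum (f := fun k => q (Y k)) (fun k _ => hq _) (Finset.mem_univ k)
    linarith
  have hJ : ∀ u ∈ P, ∀ x, q x ≤ R → JetBounded R u x := fun u hu x hx =>
    ⟨(hP.jetBounded hu x).1.trans hx, fun i => ((hP.jetBounded hu x).2 i).trans hx⟩
  refine ⟨R * R * C, fun u hu v hv => ?_⟩
  have := hC u v (fun _ => 0) (fun _ => 0) (R * R)
    (fun k => TermsClose.zero (by linarith) (hJ u hu _ (hX k)) (hJ v hv _ (hX k)))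
    (fun k => TermsClose.zero (by linarith) (hJ u hu _ (hY k)) (hJ v hv _ (hY k)))
  rwa [galerkinEmp_zero, sub_zero] at this

theorem bddAbove_of_abs_le {P : Set (Sp d → ℝ)} {F : (Sp d → ℝ) → ℝ} {C : ℝ}
    (h : ∀ v ∈ P, |F v| ≤ C) : BddAbove (Set.range fun v : P => F v) :=
  ⟨C, by rintro _ ⟨v, rfl⟩; exact (le_abs_self _).trans (h v v.2)⟩

theorem abs_ciSup_le {ι : Type*} [Nonempty ι] {F : ι → ℝ} {C : ℝ} (h : ∀ i, |F i| ≤ C) :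
    |⨆ i, F i| ≤ C := by
  have hb : BddAbove (Set.range F) := ⟨C, by rintro _ ⟨i, rfl⟩; exact (le_abs_self _).trans (h i)⟩
  rw [abs_le]
  exact ⟨(abs_le.1 (h (Classical.arbitrary ι))).1.trans (le_ciSup hb _),
    ciSup_le fun i => (le_abs_self _).trans (h i)⟩

theorem bddAbove_loss_sub_lossEmp (hd : 1 ≤ d) (hw : HasWeights p Ω W) (hΩo : IsOpen Ω)
    (hΩ : Ω ⊆ unitCube d) (htop : surf d (frontier Ω) ≠ ⊤) (hP : JetClass P G)
    (hne : P.Nonempty) (α β : ℝ) {N M : ℕ} (X : Fin N → Sp d) (Y : Fin M → Sp d) :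
    BddAbove (Set.range fun u : P => |loss p Ω α β P u - lossEmp p Ω α β P X Y u|) := by
  obtain ⟨C, hC⟩ := exists_abs_galerkin_le hd hw hΩo hΩ htop hP α β
  obtain ⟨C', hC'⟩ := exists_abs_galerkinEmp_le hP p Ω α β X Y
  have : Nonempty P := hne.to_subtype
  refine bddAbove_of_abs_le (F := fun u => |loss p Ω α β P u - lossEmp p Ω α β P X Y u|)
    (C := C + C') fun u hu => ?_
  rw [abs_abs]
  exact (abs_sub _ _).trans (add_le_add (abs_ciSup_le fun v : P => hC u hu v v.2)
    (abs_ciSup_le fun v : P => hC' u hu v v.2))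

theorem aemeasurable_galerkinEmp (hw : HasWeights p Ω W) (α β : ℝ) {N M : ℕ}
    [SigmaFinite (cond volume Ω)] [SigmaFinite (cond (surf d) (frontier Ω))]
    {u v : Sp d → ℝ} (hu : ContDiff ℝ 1 u) (hv : ContDiff ℝ 1 v) :
    AEMeasurable (fun ω : (Fin N → Sp d) × (Fin M → Sp d) => galerkinEmp p Ω α β ω.1 ω.2 u v)
      (sampleLaw Ω N M) := by
  have hX : ∀ (k : Fin N) {q : Sp d → ℝ}, AEMeasurable q (cond volume Ω) →
      AEMeasurable (fun ω : (Fin N → Sp d) × (Fin M → Sp d) => q (ω.1 k)) (sampleLaw Ω N M) :=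
    fun k q hq => hq.comp_quasiMeasurePreserving
      ((Measure.quasiMeasurePreserving_eval (fun _ : Fin N => cond volume Ω) k).comp
        Measure.quasiMeasurePreserving_fst)
  have hY : ∀ (k : Fin M) {q : Sp d → ℝ}, AEMeasurable q (cond (surf d) (frontier Ω)) →
      AEMeasurable (fun ω : (Fin N → Sp d) × (Fin M → Sp d) => q (ω.2 k)) (sampleLaw Ω N M) :=
    fun k q hq => hq.comp_quasiMeasurePreserving
      ((Measure.quasiMeasurePreserving_eval (fun _ : Fin M => cond (surf d) (frontier Ω)) k).comp
        Measure.quasiMeasurePreserving_snd)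
  have mu := hu.continuous.measurable
  have mv := hv.continuous.measurable
  have mpu := fun i => (continuous_pd i hu).measurable
  have mpv := fun i => (continuous_pd i hv).measurable
  unfold galerkinEmp
  refine ((Finset.aemeasurable_fun_sum _ fun k _ => ?_).const_mul _).add
    ((Finset.aemeasurable_fun_sum _ fun k _ => ?_).const_mul _)
  · have hint : AEMeasurable (fun x => (∑ i, ∑ j, p.a i j x * pd i u x * pd j v x) +
        (∑ i, p.b i x * pd i u x * v x) + p.c x * u x * v x - p.f x * v x) (cond volume Ω) := by
      refine (((Finset.aemeasurable_fun_sum _ fun i _ => Finset.aemeasurable_fun_sum _ fun j _ =>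
        ?_).add (Finset.aemeasurable_fun_sum _ fun i _ => ?_)).add ?_).sub ?_
      · exact ((hw.a i j).aemeasurable_cond.mul (mpu i).aemeasurable).mul (mpv j).aemeasurable
      · exact ((hw.b i).aemeasurable_cond.mul (mpu i).aemeasurable).mul mv.aemeasurable
      · exact (hw.c.aemeasurable_cond.mul mu.aemeasurable).mul mv.aemeasurable
      · exact hw.f.aemeasurable_cond.mul mv.aemeasurable
    exact hX k hint
  · have hint : AEMeasurable (fun y => α * u y * v y - p.g y * v y)
        (cond (surf d) (frontier Ω)) :=
      ((mu.const_mul α).mul mv).aemeasurable.sub (hw.g.aemeasurable_cond.mul mv.aemeasurable)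
    exact hY k hint

/-- The statistical error is measurable: almost surely, all suprema may be taken over a countable
`C¹`-dense family. -/
theorem aemeasurable_statError (hd : 1 ≤ d) (hw : HasWeights p Ω W) (hΩo : IsOpen Ω)
    (hΩ : Ω ⊆ unitCube d) (htop : surf d (frontier Ω) ≠ ⊤) (hP : JetClass P G)
    (hne : P.Nonempty) (α β : ℝ) {N M : ℕ}
    [SigmaFinite (cond volume Ω)] [SigmaFinite (cond (surf d) (frontier Ω))]
    (hmem : ∀ᵐ ω ∂(sampleLaw Ω N M), (∀ k, ω.1 k ∈ unitCube d) ∧ ∀ k, ω.2 k ∈ unitCube d) :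
    AEMeasurable (fun ω : (Fin N → Sp d) × (Fin M → Sp d) =>
      statError p Ω α β P ω.1 ω.2) (sampleLaw Ω N M) := by
  obtain ⟨r, hr⟩ := hP.exists_countable_dense hne
  obtain ⟨A, hA⟩ := exists_abs_galerkin_le hd hw hΩo hΩ htop hP α β
  obtain ⟨L, hL0, hL⟩ := exists_abs_galerkin_sub_le hw hΩo hΩ htop α β
  have : Nonempty P := hne.to_subtype
  have hd' : (1 : ℝ) ≤ d := by exact_mod_cast hd
  set R := 4 * d * G with hRdef
  have hR : 1 ≤ R := by nlinarith [hP.one_le]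
  have hself : ∀ {ε : ℝ}, 0 ≤ ε → ∀ u : Sp d → ℝ, ∀ x,
      |u x - u x| ≤ ε ∧ ∀ i, |pd i u x - pd i u x| ≤ ε := fun hε u x => by
    simp only [sub_self, abs_zero]; exact ⟨hε, fun _ => hε⟩
  -- Replacing one argument by a `C¹`-close one changes all terms by a small amount.
  have hterm₁ : ∀ {ε : ℝ}, 0 ≤ ε → ∀ u u' v : P, JetClose ε (u : Sp d → ℝ) u' →
      ∀ x ∈ unitCube d, TermsClose ((R + R) * ε) u v u' v x := fun hε u u' v h x hx =>
    TermsClose.of_close hR (hP.jetBounded_unitCube hd u.2 hx)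
      (hP.jetBounded_unitCube hd v.2 hx) (h x hx) (hself hε v x)
  have hterm₂ : ∀ {ε : ℝ}, 0 ≤ ε → ∀ u v v' : P, JetClose ε (v : Sp d → ℝ) v' →
      ∀ x ∈ unitCube d, TermsClose ((R + R) * ε) u v u v' x := fun hε u v v' h x hx =>
    TermsClose.of_close hR (hP.jetBounded_unitCube hd u.2 hx)
      (hP.jetBounded_unitCube hd v'.2 hx) (hself hε u x) (h x hx)
  have hlim : ∀ C, 0 ≤ C → ∀ η > 0, ∃ ε > 0, (R + R) * ε * C ≤ η := by
    intro C hC η hη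
    refine ⟨η / ((R + R) * (C + 1)), by positivity, ?_⟩
    have : (R + R) * (η / ((R + R) * (C + 1))) * C = η * (C / (C + 1)) := by
      field_simp
    rw [this]
    exact mul_le_of_le_one_right hη.le ((div_le_one (by positivity)).2 (by linarith))
  have hae : (fun ω : (Fin N → Sp d) × (Fin M → Sp d) => statError p Ω α β P ω.1 ω.2) =ᵐ[
      sampleLaw Ω N M] fun ω => 2 * ⨆ k, |loss p Ω α β P (r k) -
        ⨆ l, galerkinEmp p Ω α β ω.1 ω.2 (r k) (r l)| := by
    filter_upwards [hmem] with ω hω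
    obtain ⟨A', hA'⟩ := exists_abs_galerkinEmp_le hP p Ω α β ω.1 ω.2
    obtain ⟨L', hL'0, hL'⟩ := exists_abs_galerkinEmp_sub_le p Ω α β ω.1 ω.2
    have hin : ∀ u : P, lossEmp p Ω α β P ω.1 ω.2 u =
        ⨆ l, galerkinEmp p Ω α β ω.1 ω.2 u (r l) := by
      intro u
      refine ciSup_eq_ciSup_of_approx (F := fun v : P => galerkinEmp p Ω α β ω.1 ω.2 u v)
        (bddAbove_of_abs_le (hA' u u.2)) r fun v η hη => ?_
      obtain ⟨ε, hε, hεη⟩ := hlim L' hL'0 η hη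
      obtain ⟨k, hk⟩ := hr v ε hε
      exact ⟨k, (hL' u v u (r k) _ (fun k' => hterm₂ hε.le u v _ hk _ (hω.1 k'))
        fun k' => hterm₂ hε.le u v _ hk _ (hω.2 k')).trans hεη⟩
    unfold statError
    congr 1
    simp only [← hin]
    refine ciSup_eq_ciSup_of_approx
      (F := fun u : P => |loss p Ω α β P u - lossEmp p Ω α β P ω.1 ω.2 u|)
      (bddAbove_loss_sub_lossEmp hd hw hΩo hΩ htop hP hne α β ω.1 ω.2) r fun u η hη => ?_
    obtain ⟨ε, hε, hεη⟩ := hlim (L + L') (by positivity) η hη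
    obtain ⟨k, hk⟩ := hr u ε hε
    refine ⟨k, ?_⟩
    have h1 : |loss p Ω α β P u - loss p Ω α β P (r k)| ≤ (R + R) * ε * L :=
      abs_ciSup_sub_ciSup_le (bddAbove_of_abs_le (hA u u.2)) (bddAbove_of_abs_le (hA _ (r k).2))
        fun v => hL u v (r k) v (hP.grad _ u.2).1 (hP.grad _ v.2).1 (hP.grad _ (r k).2).1
          (hP.grad _ v.2).1 _ fun x hx => hterm₁ hε.le u (r k) v hk x hx
    have h2 : |lossEmp p Ω α β P ω.1 ω.2 u - lossEmp p Ω α β P ω.1 ω.2 (r k)| ≤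
        (R + R) * ε * L' :=
      abs_ciSup_sub_ciSup_le (bddAbove_of_abs_le (hA' u u.2)) (bddAbove_of_abs_le (hA' _ (r k).2))
        fun v => hL' u v (r k) v _ (fun k' => hterm₁ hε.le u (r k) v hk _ (hω.1 k'))
          fun k' => hterm₁ hε.le u (r k) v hk _ (hω.2 k')
    refine (abs_abs_sub_abs_le _ _).trans ?_
    rw [sub_sub_sub_comm]
    refine (abs_sub _ _).trans ((add_le_add h1 h2).trans ?_)
    rw [← mul_add]
    exact hεη
  refine AEMeasurable.congr ?_ hae.symm
  refine (AEMeasurable.iSup fun k => ?_).const_mul _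
  exact (aemeasurable_const.sub (AEMeasurable.iSup fun l =>
    aemeasurable_galerkinEmp hw α β (hP.grad _ (r k).2).1 (hP.grad _ (r l).2).1)).abs

end Bounds

/-! ### Expectation of the statistical error -/

section Expectation

variable {d : ℕ} {p : Coeffs d} {Ω : Set (Sp d)} {W V G : ℝ} {P : Set (Sp d → ℝ)}

/-- The expected statistical error of a class that has `m` cells of `C¹`-diameter `ε`.  Each term
of the functional is a weighted empirical mean over the class of the corresponding products, and
the deviation bounds of the terms add up.  The gradients are bounded by `G`, but the values on the
cube only by `4 d G`; the factor `d²` comes from the number of second-order terms, from one value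
and `d` first-order terms, or from two values. -/
theorem statError_expectation_le (hd : 1 ≤ d) (hw : HasWeights p Ω W) (hW : 0 < W)
    (hΩo : IsOpen Ω) (hΩne : Ω.Nonempty) (hΩ : Ω ⊆ unitCube d) (hV : 0 ≤ V)
    (h0 : surf d (frontier Ω) ≠ 0) (htop : surf d (frontier Ω) ≠ ⊤)
    (hS : (surf d).real (frontier Ω) ≤ V ^ 2) (hP : JetClass P G) (hne : P.Nonempty) (α β : ℝ)
    {ε : ℝ} (hε : 0 ≤ ε) {m : ℕ} (hm : HasCells P ε m) {N : ℕ} (hN : 1 ≤ N) :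
    Integrable (fun ω : (Fin N → Sp d) × (Fin N → Sp d) => statError p Ω α β P ω.1 ω.2)
        (sampleLaw Ω N N) ∧
      ∫ ω, statError p Ω α β P ω.1 ω.2 ∂(sampleLaw Ω N N) ≤
        384 * W * (1 + V * (|α| + 1)) * max 1 (1 / |β|) *
          (d ^ 2 * G ^ 2 * (ε + √(Real.log (2 * (m * m : ℕ)) / N))) := by
  have hG := hP.one_le
  have hd' : (1 : ℝ) ≤ d := by exact_mod_cast hd
  have hv1 := volume_ne_top hΩ
  have hv0 : volume Ω ≠ 0 := (hΩo.measure_pos volume hΩne).ne'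
  have hfm : MeasurableSet (frontier Ω) := isClosed_frontier.measurableSet
  have hfr := frontier_subset_unitCube hΩ
  have : Nonempty P := hne.to_subtype
  have iX : IsProbabilityMeasure (cond volume Ω) := cond_isProbabilityMeasure_of_finite hv0 hv1
  have iY : IsProbabilityMeasure (cond (surf d) (frontier Ω)) :=
    cond_isProbabilityMeasure_of_finite h0 htop
  set μX := Measure.pi fun _ : Fin N => cond (volume : Measure (Sp d)) Ω
  set μY := Measure.pi fun _ : Fin N => cond (surf d) (frontier Ω)
  set U := 4 * d * G with hU
  have hU0 : 0 < U := by positivity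
  set Λ := √(Real.log (2 * (m * m : ℕ)) / N) with hΛ
  have hΛ0 : 0 ≤ Λ := Real.sqrt_nonneg _
  obtain ⟨κ, hκ⟩ := hm
  -- Pairs `(u, v)` are divided into `m²` cells.
  let κ₂ : P × P → Fin (m * m) := fun t => finProdFinEquiv (κ t.1, κ t.2)
  have hκ₂ : ∀ s t, κ₂ s = κ₂ t → JetClose ε (s.1 : Sp d → ℝ) t.1 ∧
      JetClose ε (s.2 : Sp d → ℝ) t.2 := by
    intro s t h
    have h1 := finProdFinEquiv.injective h
    simp only [Prod.mk.injEq] at h1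
    exact ⟨hκ _ s.1.2 _ t.1.2 h1.1, hκ _ s.2.2 _ t.2.2 h1.2⟩
  have hu : ∀ u : P, ∀ x ∈ unitCube d, |(u : Sp d → ℝ) x| ≤ U := fun u x hx =>
    (hP.jetBounded_unitCube hd u.2 hx).1
  have hpd : ∀ u : P, ∀ i x, |pd i (u : Sp d → ℝ) x| ≤ G := fun u i x => (hP.grad _ u.2).2 i x
  have hvol : volume.real Ω ≤ 1 ^ 2 := by simpa using volume_real_le_one hΩ
  -- The deviation bounds for the single terms.
  have hbulk : ∀ {w : Sp d → ℝ}, IsWeight volume Ω W w → ∀ {h : P × P → Sp d → ℝ} {M η : ℝ},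
      0 < M → 0 ≤ η → (∀ t, Continuous (h t)) → (∀ t, ∀ x ∈ unitCube d, |h t x| ≤ M) →
      (∀ s t, κ₂ s = κ₂ t → ∀ x ∈ unitCube d, |h s x - h t x| ≤ η) →
      ∃ Ψ : (Fin N → Sp d) → ℝ, Integrable Ψ μX ∧
        (∀ᵐ X ∂μX, ∀ t, |(∫ x in Ω, w x * h t x) -
          volume.real Ω / N * ∑ k, w (X k) * h t (X k)| ≤ Ψ X) ∧
        ∫ X, Ψ X ∂μX ≤ 1 * W * (2 * η + 6 * M * Λ) := by
    intro w hw h M η hM hη hcont hhM hcell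
    exact exists_deviation_bound_cond hΩo.measurableSet hv0 hv1 zero_le_one hvol hW hw hM hη hcont
      (fun t x hx => hhM t x (hΩ hx)) κ₂ (fun s t hst x hx => hcell s t hst x (hΩ hx)) hN
  have hbdry : ∀ {w : Sp d → ℝ}, IsWeight (surf d) (frontier Ω) W w →
      ∀ {h : P × P → Sp d → ℝ} {M η : ℝ},
      0 < M → 0 ≤ η → (∀ t, Continuous (h t)) → (∀ t, ∀ x ∈ unitCube d, |h t x| ≤ M) →
      (∀ s t, κ₂ s = κ₂ t → ∀ x ∈ unitCube d, |h s x - h t x| ≤ η) →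
      ∃ Ψ : (Fin N → Sp d) → ℝ, Integrable Ψ μY ∧
        (∀ᵐ Y ∂μY, ∀ t, |(∫ y in frontier Ω, w y * h t y ∂(surf d)) -
          (surf d).real (frontier Ω) / N * ∑ k, w (Y k) * h t (Y k)| ≤ Ψ Y) ∧
        ∫ Y, Ψ Y ∂μY ≤ V * W * (2 * η + 6 * M * Λ) := by
    intro w hw h M η hM hη hcont hhM hcell
    exact exists_deviation_bound_cond hfm h0 htop hV hS hW hw hM hη hcont
      (fun t x hx => hhM t x (hfr hx)) κ₂ (fun s t hst x hx => hcell s t hst x (hfr hx)) hN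
  have cu : ∀ u : P, Continuous (u : Sp d → ℝ) := fun u => hP.continuous u.2
  have cpd : ∀ (u : P) i, Continuous (pd i (u : Sp d → ℝ)) := fun u i => hP.continuous_pd u.2 i
  have bmul : ∀ {a b A B : ℝ}, 0 ≤ A → |a| ≤ A → |b| ≤ B → |a * b| ≤ A * B := fun hA ha hb => by
    rw [abs_mul]; exact mul_le_mul ha hb (abs_nonneg _) hA
  have hG0 : 0 < G := by linarith
  -- The constant, linear and mixed factors that occur are all dominated by `d² G²`.
  have g1 : 1 ≤ d * G := one_le_mul_of_one_le_of_one_le hd' hG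
  have g2 : d * G ≤ d ^ 2 * G ^ 2 := by rw [← mul_pow]; exact le_self_pow₀ g1 two_ne_zero
  have g3 : d ^ 2 * G ≤ d ^ 2 * G ^ 2 := by gcongr; exact le_self_pow₀ hG two_ne_zero
  choose Ψa ia aa ba using fun i j => hbulk (hw.a i j)
    (h := fun t x => pd i (t.1 : Sp d → ℝ) x * pd j (t.2 : Sp d → ℝ) x) (M := G * G)
    (η := (G + G) * ε) (by positivity) (by positivity) (fun t => (cpd t.1 i).mul (cpd t.2 j))
    (fun t x _ => bmul hG0.le (hpd _ _ _) (hpd _ _ _))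
    (fun s t hst x hx => abs_mul_sub_mul_le (hpd _ _ _) (hpd _ _ _) (((hκ₂ s t hst).1 x hx).2 i)
      (((hκ₂ s t hst).2 x hx).2 j))
  choose Ψb ib ab bb using fun i => hbulk (hw.b i)
    (h := fun t x => pd i (t.1 : Sp d → ℝ) x * (t.2 : Sp d → ℝ) x) (M := G * U)
    (η := (G + U) * ε) (by positivity) (by positivity) (fun t => (cpd t.1 i).mul (cu t.2))
    (fun t x hx => bmul hG0.le (hpd _ _ _) (hu _ x hx))
    (fun s t hst x hx => abs_mul_sub_mul_le (hpd _ _ _) (hu _ x hx) (((hκ₂ s t hst).1 x hx).2 i)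
      ((hκ₂ s t hst).2 x hx).1)
  obtain ⟨Ψc, ic, ac, bc⟩ := hbulk hw.c
    (h := fun t x => (t.1 : Sp d → ℝ) x * (t.2 : Sp d → ℝ) x) (M := U * U)
    (η := (U + U) * ε) (by positivity) (by positivity) (fun t => (cu t.1).mul (cu t.2))
    (fun t x hx => bmul hU0.le (hu _ x hx) (hu _ x hx))
    (fun s t hst x hx => abs_mul_sub_mul_le (hu _ x hx) (hu _ x hx) ((hκ₂ s t hst).1 x hx).1
      ((hκ₂ s t hst).2 x hx).1)
  obtain ⟨Ψ1, i1, a1, b1⟩ := hbdry hw.one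
    (h := fun t x => (t.1 : Sp d → ℝ) x * (t.2 : Sp d → ℝ) x) (M := U * U)
    (η := (U + U) * ε) (by positivity) (by positivity) (fun t => (cu t.1).mul (cu t.2))
    (fun t x hx => bmul hU0.le (hu _ x hx) (hu _ x hx))
    (fun s t hst x hx => abs_mul_sub_mul_le (hu _ x hx) (hu _ x hx) ((hκ₂ s t hst).1 x hx).1
      ((hκ₂ s t hst).2 x hx).1)
  obtain ⟨Ψf, jf, af, bf⟩ := hbulk hw.f (h := fun t => (t.2 : Sp d → ℝ)) (M := U)
    (η := ε) hU0 hε (fun t => cu t.2) (fun t x hx => hu _ x hx)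
    (fun s t hst x hx => ((hκ₂ s t hst).2 x hx).1)
  obtain ⟨Ψg, ig, ag, bg⟩ := hbdry hw.g (h := fun t => (t.2 : Sp d → ℝ)) (M := U)
    (η := ε) hU0 hε (fun t => cu t.2) (fun t x hx => hu _ x hx)
    (fun s t hst x hx => ((hκ₂ s t hst).2 x hx).1)
  let ΨX : (Fin N → Sp d) → ℝ := fun X =>
    (∑ i, ∑ j, Ψa i j X) + (∑ i, Ψb i X) + Ψc X + Ψf X
  let ΨY : (Fin N → Sp d) → ℝ := fun Y => |α / β| * Ψ1 Y + |1 / β| * Ψg Y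
  have isa : Integrable (fun X => ∑ i, ∑ j, Ψa i j X) μX :=
    integrable_finsetSum _ fun i _ => integrable_finsetSum _ fun j _ => ia i j
  have isb : Integrable (fun X => ∑ i, Ψb i X) μX := integrable_finsetSum _ fun i _ => ib i
  have isab : Integrable (fun X => (∑ i, ∑ j, Ψa i j X) + ∑ i, Ψb i X) μX := isa.add isb
  have isabc : Integrable (fun X => (∑ i, ∑ j, Ψa i j X) + (∑ i, Ψb i X) + Ψc X) μX := isab.add ic
  have iΨX : Integrable ΨX μX := isabc.add jf
  have iΨY : Integrable ΨY μY := (i1.const_mul _).add (ig.const_mul _)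
  have hΨX : ∫ X, ΨX X ∂μX ≤ 192 * W * (d ^ 2 * G ^ 2 * (ε + Λ)) := by
    have e1 : ∫ X, ΨX X ∂μX = (∑ i, ∑ j, ∫ X, Ψa i j X ∂μX) + (∑ i, ∫ X, Ψb i X ∂μX) +
        ∫ X, Ψc X ∂μX + ∫ X, Ψf X ∂μX := by
      simp only [ΨX]
      rw [integral_add isabc jf, integral_add isab ic, integral_add isa isb,
        integral_finsetSum _ fun i _ => integrable_finsetSum _ fun j _ => ia i j,
        integral_finsetSum _ fun i _ => ib i]
      simp only [integral_finsetSum _ fun j _ => ia _ j]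
    have sa : (∑ i, ∑ j, ∫ X, Ψa i j X ∂μX) ≤
        d * (d * (1 * W * (2 * ((G + G) * ε) + 6 * (G * G) * Λ))) := by
      refine (Finset.sum_le_sum fun i _ => Finset.sum_le_sum fun j _ => ba i j).trans (le_of_eq ?_)
      simp only [Finset.sum_const, Finset.card_univ, Fintype.card_fin, nsmul_eq_mul]
    have sb : (∑ i, ∫ X, Ψb i X ∂μX) ≤ d * (1 * W * (2 * ((G + U) * ε) + 6 * (G * U) * Λ)) := by
      refine (Finset.sum_le_sum fun i _ => bb i).trans (le_of_eq ?_)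
      simp only [Finset.sum_const, Finset.card_univ, Fintype.card_fin, nsmul_eq_mul]
    have g1ε := mul_le_mul_of_nonneg_right g1 hε
    have g2ε := mul_le_mul_of_nonneg_right g2 hε
    have g3ε := mul_le_mul_of_nonneg_right g3 hε
    have g2Λ := mul_le_mul_of_nonneg_right g2 hΛ0
    have g0Λ : 0 ≤ d ^ 2 * G ^ 2 * Λ := by positivity
    rw [e1]
    calc _ ≤ d * (d * (1 * W * (2 * ((G + G) * ε) + 6 * (G * G) * Λ))) +
          d * (1 * W * (2 * ((G + U) * ε) + 6 * (G * U) * Λ)) +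
          1 * W * (2 * ((U + U) * ε) + 6 * (U * U) * Λ) + 1 * W * (2 * ε + 6 * U * Λ) := by
          linarith
      _ = W * (12 * (d ^ 2 * G * ε) + 18 * (d * G * ε) + 2 * ε + 126 * (d ^ 2 * G ^ 2 * Λ) +
          24 * (d * G * Λ)) := by rw [hU]; ring
      _ ≤ W * (192 * (d ^ 2 * G ^ 2 * (ε + Λ))) := by
          gcongr
          linarith
      _ = _ := by ring
  have hΨY : ∫ Y, ΨY Y ∂μY ≤
      192 * W * (V * (|α| + 1) * max 1 (1 / |β|)) * (d ^ 2 * G ^ 2 * (ε + Λ)) := by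
    have g1ε := mul_le_mul_of_nonneg_right g1 hε
    have g2ε := mul_le_mul_of_nonneg_right g2 hε
    have g2Λ := mul_le_mul_of_nonneg_right g2 hΛ0
    have g0Λ : 0 ≤ d ^ 2 * G ^ 2 * Λ := by positivity
    have q1 : 2 * ((U + U) * ε) + 6 * (U * U) * Λ ≤ 192 * (d ^ 2 * G ^ 2 * (ε + Λ)) := by
      have : 2 * ((U + U) * ε) + 6 * (U * U) * Λ =
        16 * (d * G * ε) + 96 * (d ^ 2 * G ^ 2 * Λ) := by rw [hU]; ring
      linarith
    have q2 : 2 * ε + 6 * U * Λ ≤ 192 * (d ^ 2 * G ^ 2 * (ε + Λ)) := by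
      have : 2 * ε + 6 * U * Λ = 2 * ε + 24 * (d * G * Λ) := by rw [hU]; ring
      linarith
    have hα : |α / β| = |α| * (1 / |β|) := by rw [abs_div]; ring
    have hβ : |1 / β| = 1 / |β| := by rw [abs_div, abs_one]
    simp only [ΨY]
    rw [integral_add (i1.const_mul _) (ig.const_mul _), integral_const_mul, integral_const_mul,
      hα, hβ]
    calc _ ≤ |α| * (1 / |β|) * (V * W * (2 * ((U + U) * ε) + 6 * (U * U) * Λ)) +
          1 / |β| * (V * W * (2 * ε + 6 * U * Λ)) := by gcongr
      _ ≤ |α| * (1 / |β|) * (V * W * (192 * (d ^ 2 * G ^ 2 * (ε + Λ)))) +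
          1 / |β| * (V * W * (192 * (d ^ 2 * G ^ 2 * (ε + Λ)))) := by gcongr
      _ = 192 * W * (V * (|α| + 1) * (1 / |β|)) * (d ^ 2 * G ^ 2 * (ε + Λ)) := by ring
      _ ≤ _ := by gcongr; exact le_max_right _ _
  have iΨ : Integrable (fun ω : (Fin N → Sp d) × (Fin N → Sp d) => 2 * (ΨX ω.1 + ΨY ω.2))
      (μX.prod μY) := ((iΨX.comp_fst μY).add (iΨY.comp_snd μX)).const_mul 2
  have hmem : ∀ᵐ ω ∂(sampleLaw Ω N N), (∀ k, ω.1 k ∈ unitCube d) ∧ ∀ k, ω.2 k ∈ unitCube d := by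
    have hX : ∀ᵐ X ∂μX, ∀ k, X k ∈ unitCube d := by
      rw [ae_all_iff]
      have h1 : ∀ᵐ x ∂(cond volume Ω), x ∈ unitCube d := by
        refine Measure.ae_smul_measure ?_ _
        filter_upwards [ae_restrict_mem hΩo.measurableSet] with x hx using hΩ hx
      exact fun k => (Measure.quasiMeasurePreserving_eval (fun _ : Fin N => cond volume Ω) k).ae h1
    have hY : ∀ᵐ Y ∂μY, ∀ k, Y k ∈ unitCube d := by
      rw [ae_all_iff]
      have h1 : ∀ᵐ x ∂(cond (surf d) (frontier Ω)), x ∈ unitCube d := by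
        refine Measure.ae_smul_measure ?_ _
        filter_upwards [ae_restrict_mem hfm] with x hx using hfr hx
      exact fun k => (Measure.quasiMeasurePreserving_eval (fun _ : Fin N => cond (surf d) (frontier Ω)) k).ae h1
    filter_upwards [Measure.quasiMeasurePreserving_fst.ae hX,
      Measure.quasiMeasurePreserving_snd.ae hY] with ω h1 h2 using ⟨h1, h2⟩
  have hdom : ∀ᵐ ω ∂(sampleLaw Ω N N),
      |statError p Ω α β P ω.1 ω.2| ≤ 2 * (ΨX ω.1 + ΨY ω.2) := by
    have aX : ∀ᵐ X ∂μX, (∀ i j, ∀ t : P × P, |(∫ x in Ω, p.a i j x *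
          (pd i (t.1 : Sp d → ℝ) x * pd j (t.2 : Sp d → ℝ) x)) - volume.real Ω / N *
          ∑ k, p.a i j (X k) * (pd i (t.1 : Sp d → ℝ) (X k) * pd j (t.2 : Sp d → ℝ) (X k))| ≤
          Ψa i j X) ∧ (∀ i, ∀ t : P × P, |(∫ x in Ω, p.b i x *
          (pd i (t.1 : Sp d → ℝ) x * (t.2 : Sp d → ℝ) x)) - volume.real Ω / N *
          ∑ k, p.b i (X k) * (pd i (t.1 : Sp d → ℝ) (X k) * (t.2 : Sp d → ℝ) (X k))| ≤ Ψb i X) := by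
      refine (ae_all_iff.2 fun i => ae_all_iff.2 fun j => aa i j).and (ae_all_iff.2 fun i => ab i)
    filter_upwards [Measure.quasiMeasurePreserving_fst.ae aX,
      Measure.quasiMeasurePreserving_fst.ae ac, Measure.quasiMeasurePreserving_fst.ae af,
      Measure.quasiMeasurePreserving_snd.ae a1, Measure.quasiMeasurePreserving_snd.ae ag]
      with ω hab hc hf h1 hg
    obtain ⟨A, hA⟩ := exists_abs_galerkin_le hd hw hΩo hΩ htop hP α β
    obtain ⟨A', hA'⟩ := exists_abs_galerkinEmp_le hP p Ω α β ω.1 ω.2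
    have hdev : ∀ u v : P, |galerkin p Ω α β u v - galerkinEmp p Ω α β ω.1 ω.2 u v| ≤
        ΨX ω.1 + ΨY ω.2 := by
      intro u v
      rw [galerkin_eq_robinForm, galerkinEmp_eq_robinForm]
      have key := abs_robinForm_sub_le p α β (u := u) (v := v) (u' := u) (v' := v)
        (I := fun w h => ∫ x in Ω, w x * h x)
        (I' := fun w h => volume.real Ω / N * ∑ k, w (ω.1 k) * h (ω.1 k))
        (J := fun w h => ∫ y in frontier Ω, w y * h y ∂(surf d))
        (J' := fun w h => (surf d).real (frontier Ω) / N * ∑ k, w (ω.2 k) * h (ω.2 k))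
        (fun i j => hab.1 i j (u, v)) (fun i => hab.2 i (u, v)) (hc (u, v)) (h1 (u, v))
        (hf (u, v)) (hg (u, v))
      refine key.trans (le_of_eq ?_)
      simp only [ΨX, ΨY]
      ring
    have hsup : ∀ u : P, |(|loss p Ω α β P u - lossEmp p Ω α β P ω.1 ω.2 u|)| ≤
        ΨX ω.1 + ΨY ω.2 := fun u => by
      rw [abs_abs]
      exact abs_ciSup_sub_ciSup_le (bddAbove_of_abs_le (hA u u.2)) (bddAbove_of_abs_le (hA' u u.2))
        fun v => hdev u v
    unfold statError
    rw [abs_mul, abs_two]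
    exact mul_le_mul_of_nonneg_left (abs_ciSup_le hsup) zero_le_two
  have hmeas := aemeasurable_statError hd hw hΩo hΩ htop hP hne α β hmem
  have hint : Integrable (fun ω : (Fin N → Sp d) × (Fin N → Sp d) =>
      statError p Ω α β P ω.1 ω.2) (sampleLaw Ω N N) :=
    iΨ.mono' hmeas.aestronglyMeasurable hdom
  refine ⟨hint, ?_⟩
  calc ∫ ω, statError p Ω α β P ω.1 ω.2 ∂(sampleLaw Ω N N)
      ≤ ∫ ω, 2 * (ΨX ω.1 + ΨY ω.2) ∂(μX.prod μY) := by
        refine integral_mono_ae hint iΨ ?_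
        filter_upwards [hdom] with ω hω using (le_abs_self _).trans hω
    _ = 2 * (∫ X, ΨX X ∂μX + ∫ Y, ΨY Y ∂μY) := by
        rw [integral_const_mul, integral_add (iΨX.comp_fst μY) (iΨY.comp_snd μX),
          integral_fun_fst, integral_fun_snd]
        simp
    _ ≤ 2 * (192 * W * max 1 (1 / |β|) * (d ^ 2 * G ^ 2 * (ε + Λ)) +
          192 * W * (V * (|α| + 1) * max 1 (1 / |β|)) * (d ^ 2 * G ^ 2 * (ε + Λ))) := by
        gcongr
        exact hΨX.trans (mul_le_mul_of_nonneg_right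
          (le_mul_of_one_le_right (by positivity) (le_max_left _ _)) (by positivity))
    _ = _ := by ring

end Expectation

/-! ### The rate for network classes -/

section Rate

variable {d : ℕ}

/-- The entropy of pairs of networks at the scale `1 / N`.  With `t = N^(1/4)`, the logarithm of the
number of cells is bounded by a multiple of `t² = √N`; the crude bound `log N ≤ 2 √N` suffices for
the rate `N^(-1/4)`.  The depth `e + 1` enters the logarithm of the grid size quadratically; one of
the two factors is absorbed by `n ^ (e + 1)`, which requires `2 ≤ n` unless `e = 0`. -/
theorem log_cells_le {n e p N : ℕ} {B t : ℝ} (hd : 1 ≤ d) (hn : 1 ≤ n) (he : e = 0 ∨ 2 ≤ n)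
    (hB : 1 ≤ B) (ht : 1 ≤ t) (htN : t ^ 4 = N) (hp : p ≤ 5 * d * n ^ e) {δ : ℝ}
    (hδ : δ = 1 / (3 * d * (n * B) ^ ((e + 6) ^ 2) * N)) :
    Real.log (2 * (((⌊2 * B / δ⌋₊ + 1) ^ p * (⌊2 * B / δ⌋₊ + 1) ^ p : ℕ) : ℝ)) ≤
      484 * d ^ 2 * (e + 1) * (n : ℝ) ^ (2 * e + 2) * B ^ 2 * t ^ 2 := by
  have hd' : (1 : ℝ) ≤ d := by exact_mod_cast hd
  have hn' : (1 : ℝ) ≤ n := by exact_mod_cast hn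
  have hN : (1 : ℝ) ≤ N := by rw [← htN]; exact one_le_pow₀ ht
  have hnB : 1 ≤ n * B := one_le_mul_of_one_le_of_one_le hn' hB
  have ht2 : 1 ≤ t ^ 2 := one_le_pow₀ ht
  set L := 3 * d * (n * B) ^ ((e + 6) ^ 2) with hL
  have hL1 : 1 ≤ L := one_le_mul_of_one_le_of_one_le (by linarith) (one_le_pow₀ hnB)
  set g : ℝ := ((⌊2 * B / δ⌋₊ + 1 : ℕ) : ℝ) with hg
  have hg1 : 1 ≤ g := by rw [hg]; exact_mod_cast Nat.le_add_left 1 _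
  have hgle : g ≤ 9 * d * (n * B) ^ ((e + 6) ^ 2) * B * N := by
    have h1 : (⌊2 * B / δ⌋₊ : ℝ) ≤ 2 * B / δ := Nat.floor_le (by rw [hδ]; positivity)
    have h2 : 2 * B / δ = 2 * (B * (L * N)) := by rw [hδ]; field_simp
    have h3 : 1 ≤ B * (L * N) :=
      one_le_mul_of_one_le_of_one_le hB (one_le_mul_of_one_le_of_one_le hL1 hN)
    calc g = ⌊2 * B / δ⌋₊ + 1 := by rw [hg]; push_cast; rfl
      _ ≤ 3 * (B * (L * N)) := by linarith
      _ = _ := by rw [hL]; ring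
  have hlogg : Real.log g ≤ 48 * (d * (e + 1) * (n : ℝ) ^ (e + 2) * B * t ^ 2) := by
    have hle : ∀ x : ℝ, 1 ≤ x → Real.log x ≤ x := fun x hx =>
      (Real.log_le_sub_one_of_pos (by linarith)).trans (by linarith)
    have h0 := Real.log_le_log (by linarith) hgle
    rw [Real.log_mul (by positivity) (by positivity), Real.log_mul (by positivity) (by positivity),
      Real.log_mul (by positivity) (by positivity), Real.log_mul (by positivity) (by positivity),
      Real.log_pow, ← htN, show t ^ 4 = (t ^ 2) ^ 2 by ring, Real.log_pow (t ^ 2) 2] at h0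
    have h9 : Real.log 9 ≤ 8 := (Real.log_le_sub_one_of_pos (by norm_num)).trans (by norm_num)
    have h4 := hle d hd'
    have h5 := hle _ hnB
    have h6 := hle B hB
    have h7 := hle _ ht2
    have hsq : ((((e + 6) ^ 2 : ℕ) : ℝ)) + 1 ≤ 37 * (e + 1) ^ 2 := by
      push_cast
      nlinarith [Nat.cast_nonneg (α := ℝ) e]
    have hen : ((e : ℝ) + 1) ≤ (n : ℝ) ^ (e + 1) := by
      rcases he with rfl | h2
      · simpa using hn'
      · have h8 : e + 1 < 2 ^ (e + 1) := Nat.lt_two_pow_self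
        have h10 : 2 ^ (e + 1) ≤ n ^ (e + 1) := Nat.pow_le_pow_left h2 _
        exact_mod_cast (h8.le.trans h10)
    have hBn : B ≤ n * B := le_mul_of_one_le_left (by linarith) hn'
    have hmain : (((e + 6) ^ 2 : ℕ) : ℝ) * Real.log (n * B) + Real.log B ≤
        37 * ((e + 1) * (n : ℝ) ^ (e + 1) * (n * B)) := by
      calc _ ≤ (((e + 6) ^ 2 : ℕ) : ℝ) * (n * B) + n * B := by gcongr; exact h6.trans hBn
        _ = ((((e + 6) ^ 2 : ℕ) : ℝ) + 1) * (n * B) := by ring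
        _ ≤ 37 * (e + 1) ^ 2 * (n * B) := by gcongr
        _ = 37 * ((e + 1) * (e + 1) * (n * B)) := by ring
        _ ≤ _ := by gcongr
    set q : ℝ := (e + 1) * (n : ℝ) ^ (e + 1) * (n * B) with hq
    have hq1 : 1 ≤ q := one_le_mul_of_one_le_of_one_le
      (one_le_mul_of_one_le_of_one_le (by linarith [Nat.cast_nonneg (α := ℝ) e])
        (one_le_pow₀ hn')) hnB
    have a1 : (1 : ℝ) ≤ d * q * t ^ 2 :=
      one_le_mul_of_one_le_of_one_le (one_le_mul_of_one_le_of_one_le hd' hq1) ht2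
    have a2 : (d : ℝ) ≤ d * q * t ^ 2 := by
      rw [mul_assoc]
      exact le_mul_of_one_le_right (by linarith) (one_le_mul_of_one_le_of_one_le hq1 ht2)
    have a3 : q ≤ d * q * t ^ 2 := by
      calc q ≤ d * q := le_mul_of_one_le_left (by linarith) hd'
        _ ≤ _ := le_mul_of_one_le_right (by positivity) ht2
    have a4 : t ^ 2 ≤ d * q * t ^ 2 :=
      le_mul_of_one_le_left (by positivity) (one_le_mul_of_one_le_of_one_le hd' hq1)
    have a5 : d * (e + 1) * (n : ℝ) ^ (e + 2) * B * t ^ 2 = d * q * t ^ 2 := by rw [hq]; ring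
    rw [a5]
    push_cast at h0 hmain ⊢
    linarith
  have hcast : (((⌊2 * B / δ⌋₊ + 1) ^ p * (⌊2 * B / δ⌋₊ + 1) ^ p : ℕ) : ℝ) = g ^ (2 * p) := by
    rw [hg]; push_cast; ring
  rw [hcast, Real.log_mul two_ne_zero (by positivity), Real.log_pow]
  have hp' : (p : ℝ) ≤ 5 * d * (n : ℝ) ^ e := by exact_mod_cast hp
  have hlog2 : Real.log 2 ≤ 1 := (Real.log_le_sub_one_of_pos (by norm_num)).trans (by norm_num)
  have h1 : 1 ≤ (d : ℝ) ^ 2 * (e + 1) * (n : ℝ) ^ (2 * e + 2) * B * t ^ 2 := by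
    have := Nat.cast_nonneg (α := ℝ) e
    exact one_le_mul_of_one_le_of_one_le (one_le_mul_of_one_le_of_one_le
      (one_le_mul_of_one_le_of_one_le (one_le_mul_of_one_le_of_one_le (one_le_pow₀ hd')
        (by linarith)) (one_le_pow₀ hn')) hB) ht2
  calc Real.log 2 + ((2 * p : ℕ) : ℝ) * Real.log g
      ≤ 1 + (2 * (5 * d * (n : ℝ) ^ e)) * (48 * (d * (e + 1) * (n : ℝ) ^ (e + 2) * B * t ^ 2)) := by
        have : 0 ≤ Real.log g := Real.log_nonneg hg1
        push_cast
        gcongr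
    _ = 1 + 480 * ((d : ℝ) ^ 2 * (e + 1) * (n : ℝ) ^ (2 * e + 2) * B * t ^ 2) := by ring
    _ ≤ 484 * ((d : ℝ) ^ 2 * (e + 1) * (n : ℝ) ^ (2 * e + 2) * B * t ^ 2) := by linarith
    _ ≤ 484 * ((d : ℝ) ^ 2 * (e + 1) * (n : ℝ) ^ (2 * e + 2) * B ^ 2 * t ^ 2) := by
        gcongr
        exact le_self_pow₀ hB two_ne_zero
    _ = _ := by ring

variable {p : Coeffs d} {Ω : Set (Sp d)} {W V : ℝ} {P : Set (Sp d → ℝ)}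

/-- A class of `C¹` functions with the growth bounds and the cells of the networks with `e + 1`
layers, `n` nonzero weights per neuron, and weights bounded by `B`. -/
structure NetLike (P : Set (Sp d → ℝ)) (n e : ℕ) (B : ℝ) : Prop where
  grad : ∀ u ∈ P, GradBounded ((n : ℝ) ^ e * B ^ (e + 1)) u
  abs_le : ∀ u ∈ P, ∀ x, |u x| ≤ 2 * ((n : ℝ) ^ e * B ^ (e + 1)) * (1 + ∑ i, |x i|)
  cells : ∀ δ > 0, ∃ q ≤ 5 * d * n ^ e,
    HasCells P (3 * d * (n * B) ^ ((e + 6) ^ 2) * δ) ((⌊2 * B / δ⌋₊ + 1) ^ q)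

theorem NetLike.jetClass {n e : ℕ} {B : ℝ} (h : NetLike P n e B) (hd : 1 ≤ d) (hn : 1 ≤ n)
    (hB : 1 ≤ B) : JetClass P ((n : ℝ) ^ e * B ^ (e + 1)) := by
  have hd' : (1 : ℝ) ≤ d := by exact_mod_cast hd
  have hn' : (1 : ℝ) ≤ n := by exact_mod_cast hn
  refine ⟨one_le_mul_of_one_le_of_one_le (one_le_pow₀ hn') (one_le_pow₀ hB), h.grad, h.abs_le,
    fun ε hε => ?_⟩
  have hL : 0 < 3 * d * (n * B) ^ ((e + 6) ^ 2) := by positivity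
  obtain ⟨q, -, hq⟩ := h.cells (ε / (3 * d * (n * B) ^ ((e + 6) ^ 2))) (by positivity)
  rw [mul_div_cancel₀ _ hL.ne'] at hq
  exact ⟨_, hq⟩

theorem NetLike.mono {n e : ℕ} {B : ℝ} {P' : Set (Sp d → ℝ)} (h : NetLike P n e B) (hP : P' ⊆ P) :
    NetLike P' n e B :=
  ⟨fun u hu => h.grad u (hP hu), fun u hu => h.abs_le u (hP hu), fun δ hδ => by
    obtain ⟨q, hq, hc⟩ := h.cells δ hδ
    exact ⟨q, hq, hc.mono hP le_rfl⟩⟩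

theorem netLike_affineClass (hd : 1 ≤ d) {B : ℝ} (hB : 1 ≤ B) :
    NetLike (affineClass d B) 1 0 B := by
  have hd' : (1 : ℝ) ≤ d := by exact_mod_cast hd
  refine ⟨fun u hu => by simpa using gradBounded_of_mem_affineClass hu, fun u hu x => ?_,
    fun δ hδ => ⟨d + 1, by omega, (hasCells_affineClass hδ).mono subset_rfl ?_⟩⟩
  · refine (abs_le_of_mem_affineClass hu x).trans ?_
    have h1 : 0 ≤ ∑ i, |x i| := Finset.sum_nonneg fun i _ => abs_nonneg _
    have h2 : 0 ≤ B * (1 + ∑ i, |x i|) := by positivity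
    simp only [pow_zero, zero_add, pow_one, one_mul]
    linarith
  · have h1 : (1 : ℝ) ≤ (((1 : ℕ) : ℝ) * B) ^ ((0 + 6) ^ 2) := by
      rw [Nat.cast_one, one_mul]; exact one_le_pow₀ hB
    gcongr
    calc (d : ℝ) + 1 ≤ 3 * d := by linarith
      _ ≤ _ := le_mul_of_one_le_right (by linarith) h1

theorem netLike_outClass {ρ : ℝ → ℝ} (hρ : IsActivation ρ) (hd : 1 ≤ d) {n : ℕ} (hn : 2 ≤ n)
    {B : ℝ} (hB : 1 ≤ B) (l : ℕ) : NetLike (outClass n B (neuronClass d ρ n B l)) n (l + 1) B := by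
  have hB0 : 0 ≤ B := by linarith
  have hn' : (1 : ℝ) ≤ n := by exact_mod_cast (by omega : 1 ≤ n)
  refine ⟨fun u hu => ?_, fun u hu x => ?_, fun δ hδ =>
    ⟨treeSize d n (l + 1), ?_, (hasCells_neuronClass_outClass hρ hd hn hB hδ l).2⟩⟩
  · have := gradBounded_of_mem_outClass hB0 (gradBounded_of_mem_neuronClass hρ hB0 l) hu
    convert this using 1
    ring
  · have h1 := abs_le_of_mem_outClass hB0 (fun h hh x => abs_le_of_mem_neuronClass hρ l hh x) hu x
    have h2 : 0 ≤ ∑ i, |x i| := Finset.sum_nonneg fun i _ => abs_nonneg _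
    have h3 : (n : ℝ) ≤ (n : ℝ) ^ (l + 1) := le_self_pow₀ hn' (by omega)
    have h4 : B ≤ B ^ (l + 1 + 1) := le_self_pow₀ hB (by omega)
    calc |u x| ≤ (n + 1) * B := h1
      _ ≤ 2 * (n * B) := by nlinarith
      _ ≤ 2 * ((n : ℝ) ^ (l + 1) * B ^ (l + 1 + 1)) := by gcongr
      _ ≤ _ := le_mul_of_one_le_right (by positivity) (by linarith)
  · have h1 := treeSize_le d hn (l + 1)
    calc treeSize d n (l + 1) ≤ n ^ (l + 1) * (d + 4) := by omega
      _ ≤ n ^ (l + 1) * (5 * d) := Nat.mul_le_mul_left _ (by omega)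
      _ = _ := by ring

/-- The rate `N^(-1/4)` for network-like classes. -/
theorem NetLike.statError_le {n e : ℕ} {B : ℝ} (h : NetLike P n e B) (hd : 1 ≤ d) (hn : 1 ≤ n)
    (he : e = 0 ∨ 2 ≤ n) (hB : 1 ≤ B) (hw : HasWeights p Ω W) (hW : 0 < W)
    (hΩo : IsOpen Ω) (hΩne : Ω.Nonempty) (hΩ : Ω ⊆ unitCube d) (hV : 0 ≤ V)
    (h0 : surf d (frontier Ω) ≠ 0) (htop : surf d (frontier Ω) ≠ ⊤)
    (hS : (surf d).real (frontier Ω) ≤ V ^ 2) (hne : P.Nonempty) (α β : ℝ)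
    {N : ℕ} (hN : 1 ≤ N) :
    Integrable (fun ω : (Fin N → Sp d) × (Fin N → Sp d) => statError p Ω α β P ω.1 ω.2)
        (sampleLaw Ω N N) ∧
      ∫ ω, statError p Ω α β P ω.1 ω.2 ∂(sampleLaw Ω N N) ≤
        384 * W * (1 + V * (|α| + 1)) * max 1 (1 / |β|) *
          (23 * (d ^ 3 * √(e + 1) * (n : ℝ) ^ (3 * e + 1) * B ^ (2 * e + 3)) /
            (N : ℝ) ^ (1 / 4 : ℝ)) := by
  have hd' : (1 : ℝ) ≤ d := by exact_mod_cast hd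
  have hn' : (1 : ℝ) ≤ n := by exact_mod_cast hn
  have hN' : (1 : ℝ) ≤ N := by exact_mod_cast hN
  set t := (N : ℝ) ^ (1 / 4 : ℝ) with ht
  have ht1 : 1 ≤ t := Real.one_le_rpow hN' (by norm_num)
  have htN : t ^ 4 = N := by
    rw [ht, ← Real.rpow_natCast, ← Real.rpow_mul (by linarith)]; norm_num
  set L := 3 * d * (n * B) ^ ((e + 6) ^ 2) with hL
  have hL0 : 0 < L := by positivity
  obtain ⟨q, hq, hc⟩ := h.cells (1 / (L * N)) (by positivity)
  have hLδ : L * (1 / (L * N)) = 1 / N := by field_simp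
  rw [hLδ] at hc
  obtain ⟨h1, h2⟩ := statError_expectation_le hd hw hW hΩo hΩne hΩ hV h0 htop hS
    (h.jetClass hd hn hB) hne α β (by positivity) hc hN
  refine ⟨h1, h2.trans ?_⟩
  have he1 : (1 : ℝ) ≤ e + 1 := by linarith [Nat.cast_nonneg (α := ℝ) e]
  have hΛ : √(Real.log (2 * (((⌊2 * B / (1 / (L * N))⌋₊ + 1) ^ q *
      (⌊2 * B / (1 / (L * N))⌋₊ + 1) ^ q : ℕ) : ℝ)) / N) ≤
      22 * (d * √(e + 1) * (n : ℝ) ^ (e + 1) * B) / t := by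
    refine Real.sqrt_le_iff.2 ⟨by positivity, ?_⟩
    have h3 := log_cells_le hd hn he hB ht1 htN hq (δ := 1 / (L * N)) rfl
    refine (div_le_div_of_nonneg_right h3 (by positivity)).trans ?_
    rw [div_pow, ← htN, div_le_div_iff₀ (by positivity) (by positivity)]
    have hs : √((e : ℝ) + 1) ^ 2 = e + 1 := Real.sq_sqrt (by linarith)
    refine le_of_eq ?_
    calc _ = 484 * d ^ 2 * √((e : ℝ) + 1) ^ 2 * (n : ℝ) ^ (2 * e + 2) * B ^ 2 * t ^ 4 := by
          rw [hs]; ring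
      _ = _ := by ring
  have hε : 1 / (N : ℝ) ≤ (d * √(e + 1) * (n : ℝ) ^ (e + 1) * B) / t := by
    have h3 : 1 ≤ d * √((e : ℝ) + 1) * (n : ℝ) ^ (e + 1) * B :=
      one_le_mul_of_one_le_of_one_le (one_le_mul_of_one_le_of_one_le
        (one_le_mul_of_one_le_of_one_le hd' (Real.one_le_sqrt.2 he1)) (one_le_pow₀ hn')) hB
    have h4 : t ≤ N := by rw [← htN]; exact le_self_pow₀ ht1 (by norm_num)
    gcongr
  have hW' : 0 ≤ 384 * W * (1 + V * (|α| + 1)) * max 1 (1 / |β|) := by positivity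
  refine mul_le_mul_of_nonneg_left ?_ hW'
  calc _ ≤ d ^ 2 * ((n : ℝ) ^ e * B ^ (e + 1)) ^ 2 *
        ((d * √(e + 1) * (n : ℝ) ^ (e + 1) * B) / t +
          22 * (d * √(e + 1) * (n : ℝ) ^ (e + 1) * B) / t) := by gcongr
    _ = _ := by ring

end Rate

/-! ### Reduction to network-like classes -/

section Reduction

variable {d : ℕ}

theorem affineClass_mono {B B' : ℝ} (h : B ≤ B') : affineClass d B ⊆ affineClass d B' := by
  rintro u ⟨a, b, ha, hb, rfl⟩
  exact ⟨a, b, fun i => (ha i).trans h, hb.trans h, rfl⟩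

/-- Every network class lies in a network-like class.  Networks with one layer and networks with a
single nonzero weight are affine; all others have at least two weights, so that the powers of `n`
absorb the depth. -/
theorem exists_netLike {ρ : ℝ → ℝ} (hρ : IsActivation ρ) (hd : 1 ≤ d) {n e : ℕ} (hn : 1 ≤ n)
    {B : ℝ} (hB : 1 ≤ B) {P : Set (Sp d → ℝ)} (hP : P ⊆ networkClass d ρ (e + 1) n B) :
    NetLike P 1 0 (2 * B) ∨ 2 ≤ n ∧ NetLike P n e B := by
  have hB0 : 0 ≤ B := by linarith
  have haff : P ⊆ affineClass d (2 * B) → NetLike P 1 0 (2 * B) := fun h =>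
    (netLike_affineClass hd (by linarith)).mono h
  rcases e with _ | e
  · exact Or.inl (haff ((hP.trans networkClass_one_subset).trans (affineClass_mono (by linarith))))
  · rcases hn.eq_or_lt with rfl | hn
    · exact Or.inl (haff (hP.trans (networkClass_one_weight_subset hρ hB0)))
    · exact Or.inr ⟨hn, (netLike_outClass hρ hd hn hB e).mono
        (hP.trans (networkClass_subset_outClass hB0))⟩

theorem sampleLaw_eq_zero {Ω : Set (Sp d)} {N M : ℕ} (hM : 1 ≤ M) (h : surf d (frontier Ω) = 0) :
    sampleLaw Ω N M = 0 := by
  have h1 : (Measure.pi fun _ : Fin M => cond (surf d) (frontier Ω)) = 0 := by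
    rw [cond_eq_zero_of_meas_eq_zero h, ← Measure.measure_univ_eq_zero, Measure.pi_univ]
    simp
    omega
  rw [sampleLaw, h1, Measure.prod_zero]

/-- The natural powers obtained in the proof are dominated by the stated ones. -/
theorem rate_le {n e k : ℕ} {B : ℝ} (hn : 1 ≤ n) (hB : 1 ≤ B) (hk : k ≤ 2 * e + 3) :
    (d : ℝ) ^ 3 * √(e + 1) * (n : ℝ) ^ (3 * e + 1) * B ^ k ≤
      (d : ℝ) ^ 3 * ((e + 1 : ℕ) : ℝ) ^ (1 / 2 : ℝ) *
        (n : ℝ) ^ (7 / 2 * ((e + 1 : ℕ) : ℝ) - 3 / 2) *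
          B ^ (7 / 2 * ((e + 1 : ℕ) : ℝ) + 1 / 2) := by
  have hn' : (1 : ℝ) ≤ n := by exact_mod_cast hn
  have he := Nat.cast_nonneg (α := ℝ) e
  have h1 : (n : ℝ) ^ (3 * e + 1) ≤ (n : ℝ) ^ (7 / 2 * ((e + 1 : ℕ) : ℝ) - 3 / 2) := by
    rw [← Real.rpow_natCast]
    refine Real.rpow_le_rpow_of_exponent_le hn' ?_
    push_cast; linarith
  have h2 : B ^ k ≤ B ^ (7 / 2 * ((e + 1 : ℕ) : ℝ) + 1 / 2) := by
    rw [← Real.rpow_natCast]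
    refine Real.rpow_le_rpow_of_exponent_le hB ?_
    have : (k : ℝ) ≤ 2 * e + 3 := by exact_mod_cast hk
    push_cast; linarith
  rw [Real.sqrt_eq_rpow]
  push_cast at h1 h2 ⊢
  gcongr

end Reduction

end DGMW

theorem mainTheorem4 (α K S : ℝ) :
    ∃ C : ℝ, ∀ (d : ℕ), 1 ≤ d →
      ∀ (Ω : Set (DGMW.Sp d)), IsOpen Ω → Ω.Nonempty →
      (∀ x ∈ Ω, ∀ i, 0 ≤ x i ∧ x i ≤ 1) →
      DGMW.surf d (frontier Ω) ≤ ENNReal.ofReal S →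
      ∀ (p : DGMW.Coeffs d), p.Admissible Ω K →
      ∀ (β : ℝ), β ≠ 0 →
      ∀ (ρ : ℝ → ℝ), Differentiable ℝ ρ →
      (∀ t, |ρ t| ≤ 1) → (∀ t, |deriv ρ t| ≤ 1) →
      LipschitzWith 1 ρ → LipschitzWith 1 (deriv ρ) →
      ∀ (D 𝔫 : ℕ), 1 ≤ D → 1 ≤ 𝔫 →
      ∀ (B : ℝ), 1 ≤ B →
      ∀ (P : Set (DGMW.Sp d → ℝ)), P.Nonempty → P ⊆ DGMW.networkClass d ρ D 𝔫 B →
      ∀ (N : ℕ), 1 ≤ N →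
        (∀ u ∈ P, BddAbove (Set.range fun v : P => DGMW.galerkin p Ω α β u v)) ∧
        (∀ (X Y : Fin N → DGMW.Sp d),
          (∀ u ∈ P, BddAbove (Set.range fun v : P => DGMW.galerkinEmp p Ω α β X Y u v)) ∧
          BddAbove (Set.range fun u : P =>
            |DGMW.loss p Ω α β P u - DGMW.lossEmp p Ω α β P X Y u|)) ∧
        Integrable (fun ω : (Fin N → DGMW.Sp d) × (Fin N → DGMW.Sp d) =>
          DGMW.statError p Ω α β P ω.1 ω.2) (DGMW.sampleLaw Ω N N) ∧
        ∫ ω, DGMW.statError p Ω α β P ω.1 ω.2 ∂(DGMW.sampleLaw Ω N N) ≤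
          C * max 1 (1 / |β|) *
            ((d : ℝ) ^ 3 * (D : ℝ) ^ (1 / 2 : ℝ) * (𝔫 : ℝ) ^ (7 / 2 * (D : ℝ) - 3 / 2) *
              B ^ (7 / 2 * (D : ℝ) + 1 / 2)) / (N : ℝ) ^ (1 / 4 : ℝ) := by
  set V := √|S| with hV
  have hV0 : 0 ≤ V := Real.sqrt_nonneg _
  set W := |K| + V + 1 with hW
  have hW0 : 0 < W := by positivity
  set C₀ := 384 * W * (1 + V * (|α| + 1)) with hC₀
  have hC₀0 : 0 ≤ C₀ := by positivity
  refine ⟨C₀ * 184, ?_⟩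
  intro d hd Ω hΩo hΩne hΩ hS p hp β _ ρ h1 h2 h3 h4 h5 D n hD hn B hB P hne hP N hN
  obtain ⟨e, rfl⟩ := Nat.exists_eq_add_of_le' hD
  have hρ : DGMW.IsActivation ρ := ⟨h1, h2, h3, h4, h5⟩
  have htop : DGMW.surf d (frontier Ω) ≠ ⊤ := (hS.trans_lt ENNReal.ofReal_lt_top).ne
  have hSV : (DGMW.surf d).real (frontier Ω) ≤ V ^ 2 := by
    rw [hV, Real.sq_sqrt (abs_nonneg S)]
    exact ENNReal.toReal_le_of_le_ofReal (abs_nonneg S)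
      (hS.trans (ENNReal.ofReal_le_ofReal (le_abs_self S)))
  have hw : DGMW.HasWeights p Ω W := hp.hasWeights hΩo hΩ
    (by linarith [le_abs_self K]) (by linarith [abs_nonneg K]) hW0.le hV0 htop hSV
  have hnet := DGMW.exists_netLike hρ hd hn hB hP
  obtain ⟨G, hJ⟩ : ∃ G, DGMW.JetClass P G := by
    rcases hnet with h | ⟨-, h⟩
    · exact ⟨_, h.jetClass hd le_rfl (by linarith)⟩
    · exact ⟨_, h.jetClass hd hn hB⟩
  obtain ⟨A, hA⟩ := DGMW.exists_abs_galerkin_le hd hw hΩo hΩ htop hJ α β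
  refine ⟨fun u hu => DGMW.bddAbove_of_abs_le (hA u hu), fun X Y => ⟨fun u hu => ?_,
    DGMW.bddAbove_loss_sub_lossEmp hd hw hΩo hΩ htop hJ hne α β X Y⟩, ?_⟩
  · obtain ⟨A', hA'⟩ := DGMW.exists_abs_galerkinEmp_le hJ p Ω α β X Y
    exact DGMW.bddAbove_of_abs_le (hA' u hu)
  by_cases h0 : DGMW.surf d (frontier Ω) = 0
  -- If the boundary had no surface area, there would be no uniform distribution on it, and the
  -- sampling law would be the zero measure.
  · rw [DGMW.sampleLaw_eq_zero hN h0]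
    simp only [integrable_zero_measure, integral_zero_measure, true_and]
    positivity
  have hrate := fun k => DGMW.rate_le (d := d) (k := k) (e := e) hn hB
  set R := (d : ℝ) ^ 3 * ((e + 1 : ℕ) : ℝ) ^ (1 / 2 : ℝ) *
    (n : ℝ) ^ (7 / 2 * ((e + 1 : ℕ) : ℝ) - 3 / 2) * B ^ (7 / 2 * ((e + 1 : ℕ) : ℝ) + 1 / 2)
  rcases hnet with h | ⟨hn2, h⟩
  · obtain ⟨i1, i2⟩ := h.statError_le hd le_rfl (Or.inl rfl) (by linarith) hw hW0 hΩo hΩne hΩ hV0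
      h0 htop hSV hne α β hN
    refine ⟨i1, i2.trans ?_⟩
    have hr := hrate 3 (by omega)
    have hn' : (1 : ℝ) ≤ n := by exact_mod_cast hn
    have hone : 1 ≤ √((e : ℝ) + 1) * (n : ℝ) ^ (3 * e + 1) :=
      one_le_mul_of_one_le_of_one_le
        (Real.one_le_sqrt.2 (by linarith [Nat.cast_nonneg (α := ℝ) e])) (one_le_pow₀ hn')
    have hd3 : (d : ℝ) ^ 3 * B ^ 3 ≤ (d : ℝ) ^ 3 * √(e + 1) * (n : ℝ) ^ (3 * e + 1) * B ^ 3 := by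
      gcongr
      rw [mul_assoc]
      exact le_mul_of_one_le_right (by positivity) hone
    calc _ = C₀ * max 1 (1 / |β|) * (184 * (d ^ 3 * B ^ 3)) / (N : ℝ) ^ (1 / 4 : ℝ) := by
          simp only [Nat.cast_zero, zero_add, Real.sqrt_one, Nat.cast_one, one_pow, mul_zero]
          ring
      _ ≤ C₀ * max 1 (1 / |β|) * (184 * R) / (N : ℝ) ^ (1 / 4 : ℝ) := by
          gcongr
          exact hd3.trans hr
      _ = _ := by ring
  · obtain ⟨i1, i2⟩ := h.statError_le hd hn (Or.inr hn2) hB hw hW0 hΩo hΩne hΩ hV0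
      h0 htop hSV hne α β hN
    refine ⟨i1, i2.trans ?_⟩
    have hr := hrate (2 * e + 3) le_rfl
    calc _ = C₀ * max 1 (1 / |β|) * (23 * (d ^ 3 * √((e : ℝ) + 1) * (n : ℝ) ^ (3 * e + 1) *
            B ^ (2 * e + 3))) / (N : ℝ) ^ (1 / 4 : ℝ) := by ring
      _ ≤ C₀ * max 1 (1 / |β|) * (184 * (d ^ 3 * √((e : ℝ) + 1) * (n : ℝ) ^ (3 * e + 1) *
            B ^ (2 * e + 3))) / (N : ℝ) ^ (1 / 4 : ℝ) := by
          gcongr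
          norm_num
      _ ≤ C₀ * max 1 (1 / |β|) * (184 * R) / (N : ℝ) ^ (1 / 4 : ℝ) := by
          gcongr
      _ = _ := by ring
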